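/- Notation. Write $\overline{\mathbf R}=\mathbf R\cup\{+\infty\}$ with $0\cdot(+\infty)=0$, $U_{n,r}=\{x\in\{0,1\}^n: \sum_i x_i=r\}$. Let $\mathcal A=\{A_1,\dots,A_r\}$ be a partition of $[n]=\{1,\dots,n\}$ with $|A_p|\ge 2$ for all $p$; put $U_{\mathcal A}=\{x\in\{0,1\}^n:\sum_{i\in A_p}x_i=1 \text{ for all } p\}$, and let $\delta_{\mathcal A}$ be $0$ on $U_{\mathcal A}$ and $+\infty$ elsewhere. A function $g:\{0,1\}^n\to\overline{\mathbf R}$ is *quadratic* if, for some integer $s\ge 0$, it equals $\sum_{i<j}a_{ij}x_ix_j+\sum_i a_ix_i$ on $U_{n,s}$ and $+\infty$ elsewhere, with $a_i\in\mathbf R$ and $a_{ij}=a_{ji}\in\overline{\mathbf R}$. It is *VCSP-quadratic of type $\mathcal A$* if moreover one can take $s=r$, $a_{ij}=+\infty$ for distinct $i,j$ in the same part of $\mathcal A$, and $a_{ij}<+\infty$ for $i,j$ in different parts. A function $g$ is *M-convex* if for all $x,y$ with $g(x),g(y)<+\infty$ and every $i$ with $x_i>y_i$ there is $j$ with $y_j>x_j$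 and $g(x)+g(y)\ge g(x-\chi_i+\chi_j)+g(y+\chi_i-\chi_j)$, where $\chi_i$ is the $i$-th unit vector; it is *QR-M$_2$-convex* if it is the sum of two quadratic M-convex functions. A function $h$ is *$\mathcal A$-linear* if $h(x)=\delta_{\mathcal A}(x)+\sum_i u_ix_i+\gamma$ for some $u\in\mathbf R^n$, $\gamma\in\mathbf R$; functions $f,f'$ are *$\mathcal A$-linearly equivalent*, $f\simeq f'$, if $f+\delta_{\mathcal A}=f'+h$ for some $\mathcal A$-linear $h$. For $X\subseteq[n]$ put $\ell_X(x)=\sum_{i,j\in X,\,i<j}x_ix_j$. The set $X$ *cuts* $A_p$ if $\emptyset\ne X\cap A_p\ne A_p$; $X$ is an *$\mathcal A$-cut* if it cuts at least two parts; $\langle X\rangle$ is the union of the parts cut by $X$. For $\mathcal A$-cuts, $X\sim Y$ means $\{\langle X\rangle\cap X,\langle X\rangle\setminus X\}=\{\langle Y\rangle\cap Y,\langle Y\rangle\setminus Y\}$. Families $\mathcal F,\mathcal G$ of $\mathcal A$-cuts satisfy $\mathcal F\sim\mathcal G$ if they represent the same set of $\sim$-classes. For positive weights $c$ on $\mathcal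 F$ and $d$ on $\mathcal G$, $c\sim d$ means that $\mathcal F\sim\mathcal G$ and $\sum_{Y\in\mathcal F,\,Y\sim X}c(Y)=\sum_{Y\in\mathcal G,\,Y\sim X}d(Y)$ for all $X$. A family is *laminar* if any two members are disjoint or one contains the other; a family $\mathcal F$ of $\mathcal A$-cuts is *laminarizable* if $\mathcal F\sim\mathcal L$ for some laminar family $\mathcal L$ of $\mathcal A$-cuts. Theorem. Let $f:\{0,1\}^n\to\overline{\mathbf R}$ be VCSP-quadratic of type $\mathcal A$. The following are equivalent: (i) $f$ is QR-M$_2$-convex; (ii) there are a laminarizable family $\mathcal F$ of $\mathcal A$-cuts and a positive weight $c$ on $\mathcal F$ with $f\simeq\sum_{X\in\mathcal F}c(X)\ell_X$; (iii) there are a laminar family $\mathcal L$ of $\mathcal A$-cuts and a positive weight $c$ on $\mathcal L$ with $f\simeq\sum_{X\in\mathcal L}c(X)\ell_X$. Moreover, the pair in (ii) is unique up to $\sim$: if $(\mathcal F,c)$ and $(\mathcal G,d)$ are both as in (ii), then $\mathcal F\sim\mathcal G$ and $c\sim d$. -/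

import Mathlib

namespace VCSPQuad

/-- The cube `{0,1}^n`. -/
abbrev Cube (n : ℕ) : Type := Fin n → Fin 2

/-- The coordinate `x_i` of a point of the cube, as a real number. -/
noncomputable def coord {n : ℕ} (x : Cube n) (i : Fin n) : ℝ := ((x i : ℕ) : ℝ)

/-- The `i`-th unit vector `χ_i`. -/
def unitVec {n : ℕ} (i : Fin n) : Cube n := Pi.single i 1

/-- `U_{n,r}`: the points of the cube with exactly `r` ones. -/
def uniformBases (n r : ℕ) : Set (Cube n) := {x | ∑ i, (x i : ℕ) = r}

/-- `U_𝒜`: the points of the cube with exactly one `1` in every part of the partition `𝒜`. -/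
def partitionBases {n : ℕ} (𝒜 : Finpartition (Finset.univ : Finset (Fin n))) : Set (Cube n) :=
  {x | ∀ A ∈ 𝒜.parts, ∑ i ∈ A, (x i : ℕ) = 1}

open Classical in
/-- The indicator function `δ_𝒜` of `U_𝒜`, with values `0` and `+∞`. -/
noncomputable def delta {n : ℕ} (𝒜 : Finpartition (Finset.univ : Finset (Fin n)))
    (x : Cube n) : WithTop ℝ :=
  if x ∈ partitionBases 𝒜 then 0 else ⊤

open Classical in
/-- The function `∑_{i<j} a_{ij} x_i x_j + ∑_i b_i x_i` on `U_{n,r}`, and `+∞` elsewhere.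
The product in `WithTop ℝ` satisfies `⊤ * 0 = 0`. -/
noncomputable def quadFun {n : ℕ} (r : ℕ) (a : Fin n → Fin n → WithTop ℝ) (b : Fin n → ℝ)
    (x : Cube n) : WithTop ℝ :=
  if x ∈ uniformBases n r then
    (∑ i, ∑ j ∈ Finset.univ.filter (fun j => i < j),
        a i j * ((coord x i * coord x j : ℝ) : WithTop ℝ)) +
      ((∑ i, b i * coord x i : ℝ) : WithTop ℝ)
  else ⊤

/-- (General) quadratic functions on the cube: the coefficients `a_{ij} = a_{ji}` may be `+∞`,
the coefficients `b_i` are finite. -/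
def IsQuadratic {n : ℕ} (g : Cube n → WithTop ℝ) : Prop :=
  ∃ (r : ℕ) (a : Fin n → Fin n → WithTop ℝ) (b : Fin n → ℝ),
    (∀ i j, a i j = a j i) ∧ g = quadFun r a b

/-- VCSP-quadratic functions of type `𝒜`; the number `r` is the number of parts of `𝒜`. -/
def IsVCSPQuadratic {n : ℕ} (𝒜 : Finpartition (Finset.univ : Finset (Fin n)))
    (f : Cube n → WithTop ℝ) : Prop :=
  ∃ (a : Fin n → Fin n → WithTop ℝ) (b : Fin n → ℝ),
    (∀ i j, a i j = a j i) ∧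
    (∀ A ∈ 𝒜.parts, ∀ i ∈ A, ∀ j ∈ A, i ≠ j → a i j = ⊤) ∧
    (∀ A ∈ 𝒜.parts, ∀ B ∈ 𝒜.parts, A ≠ B → ∀ i ∈ A, ∀ j ∈ B, a i j < ⊤) ∧
    f = quadFun 𝒜.parts.card a b

/-- M-convexity of a function on the cube. Since `x_i = 1`, `y_i = 0`, `x_j = 0`, `y_j = 1`,
the sums and differences of vectors below (computed modulo `2`) are those in `ℤ^n`. -/
def MConvex {n : ℕ} (f : Cube n → WithTop ℝ) : Prop :=
  ∀ x y : Cube n, f x < ⊤ → f y < ⊤ → ∀ i : Fin n, x i > y i →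
    ∃ j : Fin n, y j > x j ∧
      f x + f y ≥ f (x - unitVec i + unitVec j) + f (y + unitVec i - unitVec j)

/-- Quadratically representable M₂-convex (QR-M₂-convex) functions: sums of two quadratic
M-convex functions. -/
def IsQRM2Convex {n : ℕ} (f : Cube n → WithTop ℝ) : Prop :=
  ∃ f₁ f₂ : Cube n → WithTop ℝ,
    IsQuadratic f₁ ∧ MConvex f₁ ∧ IsQuadratic f₂ ∧ MConvex f₂ ∧ ∀ x, f x = f₁ x + f₂ x

/-- `𝒜`-linear functions: linear functions on `U_𝒜`, with value `+∞` outside `U_𝒜`. -/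
def IsALinear {n : ℕ} (𝒜 : Finpartition (Finset.univ : Finset (Fin n)))
    (h : Cube n → WithTop ℝ) : Prop :=
  ∃ (u : Fin n → ℝ) (γ : ℝ),
    ∀ x, h x = delta 𝒜 x + ((∑ i, u i * coord x i + γ : ℝ) : WithTop ℝ)

/-- `𝒜`-linear equivalence `f ≃ f'` of functions on the cube. -/
def ALinearEquiv {n : ℕ} (𝒜 : Finpartition (Finset.univ : Finset (Fin n)))
    (f f' : Cube n → WithTop ℝ) : Prop :=
  ∃ h : Cube n → WithTop ℝ, IsALinear 𝒜 h ∧ ∀ x, f x + delta 𝒜 x = f' x + h x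

/-- `ℓ_X(x) = ∑_{i,j ∈ X, i<j} x_i x_j`. -/
noncomputable def ell {n : ℕ} (X : Finset (Fin n)) (x : Cube n) : ℝ :=
  ∑ i ∈ X, ∑ j ∈ X.filter (fun j => i < j), coord x i * coord x j

/-- The function `∑_{X ∈ F} c(X) ℓ_X`. -/
noncomputable def cutSum {n : ℕ} (F : Finset (Finset (Fin n))) (c : Finset (Fin n) → ℝ)
    (x : Cube n) : WithTop ℝ :=
  ((∑ X ∈ F, c X * ell X x : ℝ) : WithTop ℝ)

/-- `X` cuts `A` if `∅ ≠ X ∩ A ≠ A`. -/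
def Cuts {n : ℕ} (X A : Finset (Fin n)) : Prop := (X ∩ A).Nonempty ∧ X ∩ A ≠ A

/-- `X` is an `𝒜`-cut if it cuts at least two parts of `𝒜`. -/
def IsCut {n : ℕ} (𝒜 : Finpartition (Finset.univ : Finset (Fin n))) (X : Finset (Fin n)) : Prop :=
  ∃ A ∈ 𝒜.parts, ∃ B ∈ 𝒜.parts, A ≠ B ∧ Cuts X A ∧ Cuts X B

open Classical in
/-- The cutting support `⟨X⟩`: the union of the parts of `𝒜` cut by `X`. -/
noncomputable def cutSupport {n : ℕ} (𝒜 : Finpartition (Finset.univ : Finset (Fin n)))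
    (X : Finset (Fin n)) : Finset (Fin n) :=
  (𝒜.parts.filter (fun A => Cuts X A)).sup id

/-- `𝒜`-equivalence `X ∼ Y` of `𝒜`-cuts: equality of the unordered pairs
`{⟨X⟩ ∩ X, ⟨X⟩ \ X}` and `{⟨Y⟩ ∩ Y, ⟨Y⟩ \ Y}`. -/
def CutEquiv {n : ℕ} (𝒜 : Finpartition (Finset.univ : Finset (Fin n)))
    (X Y : Finset (Fin n)) : Prop :=
  ({cutSupport 𝒜 X ∩ X, cutSupport 𝒜 X \ X} : Set (Finset (Fin n))) =
    {cutSupport 𝒜 Y ∩ Y, cutSupport 𝒜 Y \ Y}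

/-- `𝒜`-cut families. -/
def IsCutFamily {n : ℕ} (𝒜 : Finpartition (Finset.univ : Finset (Fin n)))
    (F : Finset (Finset (Fin n))) : Prop :=
  ∀ X ∈ F, IsCut 𝒜 X

/-- `𝒜`-equivalence `F ∼ G` of `𝒜`-cut families: the members of `F` and those of `G` represent
the same equivalence classes. -/
def FamilyEquiv {n : ℕ} (𝒜 : Finpartition (Finset.univ : Finset (Fin n)))
    (F G : Finset (Finset (Fin n))) : Prop :=
  (∀ X ∈ F, ∃ Y ∈ G, CutEquiv 𝒜 X Y) ∧ (∀ Y ∈ G, ∃ X ∈ F, CutEquiv 𝒜 Y X)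

open Classical in
/-- `𝒜`-equivalence `c ∼ d` of a weight `c` on `F` and a weight `d` on `G`. -/
def WeightEquiv {n : ℕ} (𝒜 : Finpartition (Finset.univ : Finset (Fin n)))
    (F : Finset (Finset (Fin n))) (c : Finset (Fin n) → ℝ)
    (G : Finset (Finset (Fin n))) (d : Finset (Fin n) → ℝ) : Prop :=
  FamilyEquiv 𝒜 F G ∧
    ∀ X : Finset (Fin n),
      ∑ Y ∈ F.filter (fun Y => CutEquiv 𝒜 Y X), c Y =
        ∑ Y ∈ G.filter (fun Y => CutEquiv 𝒜 Y X), d Y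

/-- Laminar families. -/
def IsLaminar {n : ℕ} (F : Finset (Finset (Fin n))) : Prop :=
  ∀ X ∈ F, ∀ Y ∈ F, X ⊆ Y ∨ Y ⊆ X ∨ X ∩ Y = ∅

/-- Laminarizable `𝒜`-cut families: `𝒜`-cut families `𝒜`-equivalent to a laminar
`𝒜`-cut family. -/
def IsLaminarizable {n : ℕ} (𝒜 : Finpartition (Finset.univ : Finset (Fin n)))
    (F : Finset (Finset (Fin n))) : Prop :=
  IsCutFamily 𝒜 F ∧
    ∃ L : Finset (Finset (Fin n)), IsCutFamily 𝒜 L ∧ IsLaminar L ∧ FamilyEquiv 𝒜 F L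

/-- `c` is a positive weight on `F`; the values of `c` outside `F` are irrelevant. -/
def IsPosWeight {n : ℕ} (F : Finset (Finset (Fin n))) (c : Finset (Fin n) → ℝ) : Prop :=
  ∀ X ∈ F, 0 < c X

end VCSPQuad

open VCSPQuad

/-! On `U_𝒜`, a quadratic form modulo affine functions is the same thing as its cross minors `a i j
+ a k l - a i l - a k j`, with `i, k` in one part and `j, l` in another. So the theorem is a
statement about which systems of minors come from weighted cut families, and how uniquely
(`IsVCSPMatrix.aLinearEquiv_cutSum_iff`).

Laminar implies convex: for a laminar family, one exchange partner suits all members simultaneously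
(`IsLaminar.exists_exchange`), so a positive combination of the `ℓ_X` is M-convex on each layer
`U_{n,r}`. Adding the M-convex `δ_𝒜` restricts it to `U_𝒜`.

Convex implies laminar: M-convexity of a summand gives a four-point inequality for its coefficients.
By it, having coefficient `⊤` is a transitive relation inside a part. The two summands' relations
jointly cover all pairs of a part, so one of them does so alone
(`forall_or_forall_of_union_complete`). Hence a part contains finite inner coefficients ("is split")
for at most one summand. A summand's minors vanish unless both parts are split; on split parts,
subtracting the row of a base point turns the four-point inequality into an ultrametric one, whose
level classes are laminar. The two resulting families live on disjoint unions of parts and can be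
united.

Uniqueness: a laminar family cannot separate both `ij|kl` and `il|kj`, so the positive part of a
minor is the total weight of the members separating `ij|kl`. For each cut `Z` there is a quartet
separated only by members that induce the bipartition of `Z` (`IsLaminar.exists_quartet`). The total
weight of the members extending `Z` is therefore determined, and induction from large supports to
small ones isolates each class. -/

namespace VCSPQuad

/-! ### Quadratic forms on transversals and their cross minors -/

section Basics

open Finset

variable {n : ℕ}

/-- The sum of `a i j` over the pairs `i < j` in `B`. -/
def pairSum {M : Type*} [AddCommMonoid M] (a : Fin n → Fin n → M) (B : Finset (Fin n)) : M :=
  ∑ i ∈ B, ∑ j ∈ B with i < j, a i j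

theorem pairSum_insert {M : Type*} [AddCommMonoid M] {a : Fin n → Fin n → M}
    (ha : ∀ i j, a i j = a j i) {i : Fin n} {B : Finset (Fin n)} (hi : i ∉ B) :
    pairSum a (insert i B) = ∑ j ∈ B, a i j + pairSum a B := by
  unfold pairSum
  rw [sum_insert hi]
  have h1 : ∑ j ∈ insert i B with i < j, a i j = ∑ j ∈ B, if i < j then a i j else 0 := by
    rw [sum_filter, sum_insert hi]; simp
  have h2 : ∀ k ∈ B, ∑ j ∈ insert i B with k < j, a k j =
      (if k < i then a i k else 0) + ∑ j ∈ B with k < j, a k j := by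
    intro k _
    rw [sum_filter, sum_insert hi, sum_filter, ha i k]
  rw [h1, sum_congr rfl h2, sum_add_distrib, ← add_assoc, ← sum_add_distrib]
  congr 1
  refine sum_congr rfl fun j hj => ?_
  have hne : i ≠ j := fun h => hi (h ▸ hj)
  rcases lt_or_gt_of_ne hne with h | h
  · simp [h, h.not_gt]
  · simp [h, h.not_gt]

theorem two_mul_pairSum {a : Fin n → Fin n → ℝ} (ha : ∀ i j, a i j = a j i) (B : Finset (Fin n)) :
    2 * pairSum a B = ∑ i ∈ B, ∑ j ∈ B.erase i, a i j := by
  induction B using Finset.induction_on with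
  | empty => simp [pairSum]
  | insert i B hi ih =>
    rw [pairSum_insert ha hi, sum_insert hi, erase_insert hi, mul_add, ih]
    have : ∀ k ∈ B, ∑ j ∈ (insert i B).erase k, a k j = a i k + ∑ j ∈ B.erase k, a k j := by
      intro k hk
      have hne : i ≠ k := fun h => hi (h ▸ hk)
      rw [erase_insert_of_ne hne, sum_insert (fun h => hi (mem_of_mem_erase h)), ha i k]
    rw [sum_congr rfl this, sum_add_distrib]
    ring

/-- The set of coordinates at which a point of the cube is `1`. -/
def supp (x : Cube n) : Finset (Fin n) := univ.filter fun i => x i = 1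

/-- The point of the cube with a given support. -/
def ind (B : Finset (Fin n)) : Cube n := fun i => if i ∈ B then 1 else 0

@[simp] theorem mem_supp {x : Cube n} {i : Fin n} : i ∈ supp x ↔ x i = 1 := by simp [supp]

@[simp] theorem supp_ind (B : Finset (Fin n)) : supp (ind B) = B := by
  ext i; simp [ind]

@[simp] theorem ind_supp (x : Cube n) : ind (supp x) = x := by
  funext i
  simp only [ind, mem_supp]
  split_ifs with h
  · exact h.symm
  · generalize x i = t at h; revert h; revert t; decide

theorem val_eq_ite (x : Cube n) (i : Fin n) : (x i : ℕ) = if i ∈ supp x then 1 else 0 := by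
  simp only [mem_supp]
  generalize x i = t; revert t; decide

theorem coord_eq_ite (x : Cube n) (i : Fin n) : coord x i = if i ∈ supp x then 1 else 0 := by
  rw [coord, val_eq_ite]; split_ifs <;> simp

theorem sum_val (x : Cube n) (A : Finset (Fin n)) : ∑ i ∈ A, (x i : ℕ) = (A ∩ supp x).card := by
  simp only [val_eq_ite]
  rw [sum_ite_mem, card_eq_sum_ones]

theorem mem_uniformBases {x : Cube n} {r : ℕ} : x ∈ uniformBases n r ↔ (supp x).card = r := by
  rw [uniformBases, Set.mem_ofPred_eq, sum_val, univ_inter]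

theorem sum_mul_coord (u : Fin n → ℝ) (x : Cube n) :
    ∑ i, u i * coord x i = ∑ i ∈ supp x, u i := by
  simp only [coord_eq_ite, mul_ite, mul_one, mul_zero]
  rw [sum_ite_mem, univ_inter]

theorem quadFun_eq (r : ℕ) (a : Fin n → Fin n → WithTop ℝ) (b : Fin n → ℝ) (x : Cube n) :
    quadFun r a b x = if (supp x).card = r then
      pairSum a (supp x) + ((∑ i ∈ supp x, b i : ℝ) : WithTop ℝ) else ⊤ := by
  unfold quadFun
  simp only [mem_uniformBases, sum_mul_coord]
  split_ifs with h
  · congr 1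
    have : ∀ i, (∑ j with i < j, a i j * ((coord x i * coord x j : ℝ) : WithTop ℝ)) =
        if i ∈ supp x then ∑ j ∈ supp x with i < j, a i j else 0 := by
      intro i
      split_ifs with hi
      · rw [sum_filter, sum_filter, ← sum_filter_add_sum_filter_not univ (· ∈ supp x)]
        have h0 : (∑ j with j ∉ supp x,
            if i < j then a i j * ((coord x i * coord x j : ℝ) : WithTop ℝ) else 0) = 0 := by
          refine sum_eq_zero fun j hj => ?_
          simp only [mem_filter, mem_univ, true_and] at hj
          simp [coord_eq_ite x j, hj]
        rw [h0, add_zero]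
        have hf : (univ.filter (· ∈ supp x)) = supp x := by ext; simp
        rw [hf]
        refine sum_congr rfl fun j hj => ?_
        simp [coord_eq_ite, hi, hj]
      · refine sum_eq_zero fun j _ => ?_
        simp [coord_eq_ite x i, hi]
    rw [sum_congr rfl fun i _ => this i, sum_ite_mem, univ_inter, pairSum]
  · rfl

theorem pairSum_lt_top {a : Fin n → Fin n → WithTop ℝ} {B : Finset (Fin n)} :
    pairSum a B < ⊤ ↔ ∀ i ∈ B, ∀ j ∈ B, i < j → a i j < ⊤ := by
  simp [pairSum, WithTop.sum_lt_top]

theorem pairSum_lt_top_of_symm {a : Fin n → Fin n → WithTop ℝ} (ha : ∀ i j, a i j = a j i)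
    {B : Finset (Fin n)} :
    pairSum a B < ⊤ ↔ ∀ i ∈ B, ∀ j ∈ B, i ≠ j → a i j < ⊤ := by
  rw [pairSum_lt_top]
  refine ⟨fun h i hi j hj hij => ?_, fun h i hi j hj hij => h i hi j hj hij.ne⟩
  rcases lt_or_gt_of_ne hij with h' | h'
  · exact h i hi j hj h'
  · rw [ha]; exact h j hj i hi h'

theorem quadFun_lt_top {r : ℕ} {a : Fin n → Fin n → WithTop ℝ} (ha : ∀ i j, a i j = a j i)
    {b : Fin n → ℝ} {x : Cube n} :
    quadFun r a b x < ⊤ ↔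
      (supp x).card = r ∧ ∀ i ∈ supp x, ∀ j ∈ supp x, i ≠ j → a i j < ⊤ := by
  rw [quadFun_eq, ← pairSum_lt_top_of_symm ha]
  split_ifs with h
  · simp [h]
  · simp [h]

theorem pairSum_coe (a : Fin n → Fin n → ℝ) (B : Finset (Fin n)) :
    pairSum (fun i j => (a i j : WithTop ℝ)) B = (pairSum a B : ℝ) := by
  simp [pairSum, WithTop.coe_sum]

theorem pairSum_congr {M : Type*} [AddCommMonoid M] {a b : Fin n → Fin n → M}
    {B : Finset (Fin n)} (h : ∀ i ∈ B, ∀ j ∈ B, i ≠ j → a i j = b i j) :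
    pairSum a B = pairSum b B := by
  refine sum_congr rfl fun i hi => sum_congr rfl fun j hj => ?_
  rw [mem_filter] at hj
  exact h i hi j hj.1 hj.2.ne

theorem pairSum_sub (a b : Fin n → Fin n → ℝ) (B : Finset (Fin n)) :
    pairSum (fun i j => a i j - b i j) B = pairSum a B - pairSum b B := by
  simp [pairSum, sum_sub_distrib]

/-- The matrix of the quadratic form `∑_{X ∈ F} c(X) ℓ_X`. -/
def cutMat (F : Finset (Finset (Fin n))) (c : Finset (Fin n) → ℝ) (i j : Fin n) : ℝ :=
  ∑ X ∈ F, c X * ((if i ∈ X then 1 else 0) * (if j ∈ X then 1 else 0))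

theorem cutMat_symm (F : Finset (Finset (Fin n))) (c : Finset (Fin n) → ℝ) (i j : Fin n) :
    cutMat F c i j = cutMat F c j i :=
  sum_congr rfl fun X _ => by ring

theorem ell_eq (X : Finset (Fin n)) (x : Cube n) :
    ell X x = pairSum (fun i j => (if i ∈ X then 1 else 0) * (if j ∈ X then 1 else 0) : _ → _ → ℝ)
      (supp x) := by
  have h1 : ell X x = ∑ i, ∑ j, if i < j then
      ((if i ∈ X then 1 else 0) * (if j ∈ X then 1 else 0)) *
        ((if i ∈ supp x then 1 else 0) * (if j ∈ supp x then 1 else 0) : ℝ) else 0 := by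
    unfold ell
    rw [← sum_subset (subset_univ X)]
    · refine sum_congr rfl fun i hi => ?_
      rw [sum_filter, ← sum_subset (subset_univ X)]
      · refine sum_congr rfl fun j hj => ?_
        simp only [coord_eq_ite, hi, hj, if_true, one_mul]
      · intro j _ hj; simp [hj]
    · intro i _ hi; simp [hi]
  rw [h1]
  unfold pairSum
  symm
  rw [← sum_subset (subset_univ (supp x))]
  · refine sum_congr rfl fun i hi => ?_
    rw [sum_filter, ← sum_subset (subset_univ (supp x))]
    · refine sum_congr rfl fun j hj => ?_
      simp only [hi, hj, if_true, mul_one]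
    · intro j _ hj; simp only [hj, if_false, mul_zero, ite_self]
  · intro i _ hi; simp only [hi, if_false, zero_mul, mul_zero, ite_self, sum_const_zero]

theorem cutSum_eq (F : Finset (Finset (Fin n))) (c : Finset (Fin n) → ℝ) (x : Cube n) :
    cutSum F c x = (pairSum (cutMat F c) (supp x) : ℝ) := by
  unfold cutSum
  congr 1
  simp only [ell_eq, pairSum, cutMat, mul_sum]
  rw [sum_comm]
  refine sum_congr rfl fun i _ => ?_
  rw [sum_comm]

/-- The sets that contain exactly one element of every part of `𝒜`. -/
def IsTransversal (𝒜 : Finpartition (univ : Finset (Fin n))) (B : Finset (Fin n)) : Prop :=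
  (∀ i ∈ B, ∀ j ∈ B, 𝒜.part i = 𝒜.part j → i = j) ∧ B.card = 𝒜.parts.card

variable {𝒜 : Finpartition (univ : Finset (Fin n))}

theorem part_mem_parts (i : Fin n) : 𝒜.part i ∈ 𝒜.parts := 𝒜.part_mem.2 (mem_univ i)

theorem mem_own_part (i : Fin n) : i ∈ 𝒜.part i := 𝒜.mem_part_self.2 (mem_univ i)

theorem part_eq_iff {i : Fin n} {A : Finset (Fin n)} (hA : A ∈ 𝒜.parts) :
    𝒜.part i = A ↔ i ∈ A := 𝒜.part_eq_iff_mem hA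

theorem IsTransversal.image_part {B : Finset (Fin n)} (hB : IsTransversal 𝒜 B) :
    B.image 𝒜.part = 𝒜.parts := by
  refine eq_of_subset_of_card_le (fun A hA => ?_) ?_
  · obtain ⟨i, _, rfl⟩ := mem_image.1 hA
    exact part_mem_parts i
  · rw [card_image_of_injOn fun i hi j hj h => hB.1 i hi j hj h, hB.2]

theorem IsTransversal.sum_part {B : Finset (Fin n)} (hB : IsTransversal 𝒜 B)
    (g : Finset (Fin n) → ℝ) : ∑ i ∈ B, g (𝒜.part i) = ∑ A ∈ 𝒜.parts, g A := by
  rw [← hB.image_part, sum_image fun i hi j hj h => hB.1 i hi j hj h]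

theorem IsTransversal.sum_part_erase {B : Finset (Fin n)} (hB : IsTransversal 𝒜 B) {i : Fin n}
    (hi : i ∈ B) (g : Finset (Fin n) → ℝ) :
    ∑ j ∈ B.erase i, g (𝒜.part j) = ∑ A ∈ 𝒜.parts.erase (𝒜.part i), g A := by
  have h1 := add_sum_erase B (fun j => g (𝒜.part j)) hi
  have h2 := add_sum_erase 𝒜.parts g (part_mem_parts (𝒜 := 𝒜) i)
  have h3 := hB.sum_part g
  linarith

/-- The numbers `|A ∩ supp x|` add up to `|supp x|`, so "exactly one per part" amounts to "at most
one per part" together with the right cardinality. -/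
theorem mem_partitionBases {x : Cube n} :
    x ∈ partitionBases 𝒜 ↔ IsTransversal 𝒜 (supp x) := by
  have key : (∑ A ∈ 𝒜.parts, (A ∩ supp x).card) = (supp x).card := by
    have := card_eq_sum_card_fiberwise (s := supp x) (t := 𝒜.parts) (f := 𝒜.part)
      fun i _ => part_mem_parts i
    rw [this]
    refine sum_congr rfl fun A hA => ?_
    congr 1
    ext i
    simp [part_eq_iff hA, and_comm]
  constructor
  · intro h
    have h' : ∀ A ∈ 𝒜.parts, (A ∩ supp x).card = 1 := fun A hA => by
      rw [← sum_val]; exact h A hA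
    refine ⟨fun i hi j hj hij => ?_, ?_⟩
    · have := card_le_one.1 (h' _ (part_mem_parts i)).le
      exact this i (mem_inter.2 ⟨mem_own_part i, hi⟩) j
        (mem_inter.2 ⟨hij ▸ mem_own_part j, hj⟩)
    · rw [← key, sum_congr rfl h', card_eq_sum_ones]
  · intro h A hA
    rw [sum_val]
    refine le_antisymm (card_le_one.2 fun i hi j hj => ?_) (card_pos.2 ?_)
    · rw [mem_inter] at hi hj
      exact h.1 i hi.2 j hj.2 (((part_eq_iff hA).2 hi.1).trans ((part_eq_iff hA).2 hj.1).symm)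
    · obtain ⟨i, hi, hiA⟩ := mem_image.1 (h.image_part ▸ hA)
      exact ⟨i, mem_inter.2 ⟨(part_eq_iff hA).1 hiA, hi⟩⟩

theorem delta_eq (x : Cube n) [Decidable (IsTransversal 𝒜 (supp x))] :
    delta 𝒜 x = if IsTransversal 𝒜 (supp x) then 0 else ⊤ := by
  unfold delta
  simp only [mem_partitionBases]

/-- The alternating sum of a matrix over the rows `i, k` and the columns `j, l`. -/
def minor (a : Fin n → Fin n → ℝ) (i k j l : Fin n) : ℝ := a i j + a k l - a i l - a k j

/-- Agreement of all alternating sums with rows in one part of `𝒜`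
and columns in another part. -/
def CrossMinorsEq (𝒜 : Finpartition (univ : Finset (Fin n))) (a b : Fin n → Fin n → ℝ) : Prop :=
  ∀ i k j l, 𝒜.part i = 𝒜.part k → 𝒜.part j = 𝒜.part l → 𝒜.part i ≠ 𝒜.part j →
    minor a i k j l = minor b i k j l

/-- Fix a representative in each part. A zero minor writes `a i j` as a term in `i` and the part of
`j`, plus a term in `j` and the part of `i`, minus a term in the two parts. Summed over a
transversal, the first two are linear and the last is constant. -/
theorem exists_linear_of_minor_eq_zero {a : Fin n → Fin n → ℝ} (ha : ∀ i j, a i j = a j i)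
    (h : ∀ i k j l, 𝒜.part i = 𝒜.part k → 𝒜.part j = 𝒜.part l → 𝒜.part i ≠ 𝒜.part j →
      minor a i k j l = 0) :
    ∃ (u : Fin n → ℝ) (γ : ℝ), ∀ B, IsTransversal 𝒜 B → pairSum a B = ∑ i ∈ B, u i + γ := by
  classical
  by_cases hn : Nonempty (Fin n)
  swap
  · refine ⟨0, 0, fun B _ => ?_⟩
    have : B = ∅ := eq_empty_of_forall_notMem fun i _ => hn ⟨i⟩
    simp [this, pairSum]
  choose! z hz using fun (A : Finset (Fin n)) (hA : A ∈ 𝒜.parts) => 𝒜.nonempty_of_mem_parts hA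
  have hz' : ∀ A ∈ 𝒜.parts, 𝒜.part (z A) = A := fun A hA => (part_eq_iff hA).2 (hz A hA)
  -- Over ordered pairs the two linear terms have equal sums, which absorbs the factor `1/2`; the
  -- constant keeps it.
  refine ⟨fun i => ∑ A ∈ 𝒜.parts.erase (𝒜.part i), a i (z A),
    -(1 / 2) * ∑ A ∈ 𝒜.parts, ∑ A' ∈ 𝒜.parts.erase A, a (z A) (z A'), fun B hB => ?_⟩
  have hpt : ∀ i ∈ B, ∀ j ∈ B.erase i, a i j = a i (z (𝒜.part j)) + a j (z (𝒜.part i)) -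
      a (z (𝒜.part i)) (z (𝒜.part j)) := by
    intro i hi j hj
    obtain ⟨hji, hj⟩ := mem_erase.1 hj
    have := h i (z (𝒜.part i)) j (z (𝒜.part j)) (hz' _ (part_mem_parts i)).symm
      (hz' _ (part_mem_parts j)).symm (fun e => hji (hB.1 i hi j hj e).symm)
    simp only [minor] at this
    have h2 := ha (z (𝒜.part i)) j
    linarith
  have e1 : ∀ i ∈ B, ∑ j ∈ B.erase i, a i (z (𝒜.part j)) =
      ∑ A ∈ 𝒜.parts.erase (𝒜.part i), a i (z A) := fun i hi =>
    hB.sum_part_erase hi fun A => a i (z A)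
  have e2 : ∑ i ∈ B, ∑ j ∈ B.erase i, a j (z (𝒜.part i)) =
      ∑ i ∈ B, ∑ j ∈ B.erase i, a i (z (𝒜.part j)) := by
    rw [sum_comm' (t' := B) (s' := fun j => B.erase j)]
    intro i j
    simp only [mem_erase]
    exact ⟨fun h => ⟨⟨h.2.1.symm, h.1⟩, h.2.2⟩, fun h => ⟨h.1.2, h.1.1.symm, h.2⟩⟩
  have e3 : ∑ i ∈ B, ∑ j ∈ B.erase i, a (z (𝒜.part i)) (z (𝒜.part j)) =
      ∑ A ∈ 𝒜.parts, ∑ A' ∈ 𝒜.parts.erase A, a (z A) (z A') := by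
    rw [← hB.sum_part fun A => ∑ A' ∈ 𝒜.parts.erase A, a (z A) (z A')]
    exact sum_congr rfl fun i hi => hB.sum_part_erase hi fun A => a (z (𝒜.part i)) (z A)
  have h2 := two_mul_pairSum ha B
  rw [sum_congr rfl fun i hi => sum_congr rfl (hpt i hi)] at h2
  simp only [sum_sub_distrib, sum_add_distrib] at h2
  rw [e2, e3, sum_congr rfl e1] at h2
  linarith

/-- The same `R` serves all `k` and `l`, so that an alternating sum over four transversals isolates
a minor. -/
theorem exists_transversal_extension {i j : Fin n} (hij : 𝒜.part i ≠ 𝒜.part j) :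
    ∃ R : Finset (Fin n), ∀ k l, 𝒜.part k = 𝒜.part i → 𝒜.part l = 𝒜.part j →
      l ∉ R ∧ k ∉ insert l R ∧ IsTransversal 𝒜 (insert k (insert l R)) := by
  classical
  have hn : Nonempty (Fin n) := ⟨i⟩
  choose! z hz using fun (A : Finset (Fin n)) (hA : A ∈ 𝒜.parts) => 𝒜.nonempty_of_mem_parts hA
  have hz' : ∀ A ∈ 𝒜.parts, 𝒜.part (z A) = A := fun A hA => (part_eq_iff hA).2 (hz A hA)
  have hR : ∀ m ∈ ((𝒜.parts.erase (𝒜.part i)).erase (𝒜.part j)).image z,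
      𝒜.part m ≠ 𝒜.part i ∧ 𝒜.part m ≠ 𝒜.part j ∧ z (𝒜.part m) = m := by
    intro m hm
    obtain ⟨A, hA, rfl⟩ := mem_image.1 hm
    simp only [mem_erase] at hA
    rw [hz' A hA.2.2]
    exact ⟨hA.2.1, hA.1, rfl⟩
  refine ⟨((𝒜.parts.erase (𝒜.part i)).erase (𝒜.part j)).image z, fun k l hk hl => ?_⟩
  have hlR : l ∉ ((𝒜.parts.erase (𝒜.part i)).erase (𝒜.part j)).image z :=
    fun h => (hR l h).2.1 hl
  have hkR : k ∉ insert l (((𝒜.parts.erase (𝒜.part i)).erase (𝒜.part j)).image z) := by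
    rw [mem_insert, not_or]
    exact ⟨fun h => hij (by rw [← hk, h, hl]), fun h => (hR k h).1 hk⟩
  refine ⟨hlR, hkR, ?_, ?_⟩
  · intro s hs t ht hst
    simp only [mem_insert] at hs ht
    rcases hs with rfl | rfl | hs <;> rcases ht with rfl | rfl | ht
    · rfl
    · exact absurd (hk.symm.trans (hst.trans hl)) hij
    · exact absurd (hst.symm.trans hk) (hR t ht).1
    · exact absurd (hk.symm.trans (hst.symm.trans hl)) hij
    · rfl
    · exact absurd (hst.symm.trans hl) (hR t ht).2.1
    · exact absurd (hst.trans hk) (hR s hs).1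
    · exact absurd (hst.trans hl) (hR s hs).2.1
    · rw [← (hR s hs).2.2, ← (hR t ht).2.2, hst]
  · rw [card_insert_of_notMem hkR, card_insert_of_notMem hlR, card_image_of_injOn,
      card_erase_of_mem (mem_erase.2 ⟨hij.symm, part_mem_parts j⟩),
      card_erase_of_mem (part_mem_parts i)]
    · have : 2 ≤ 𝒜.parts.card := by
        rw [← card_pair hij]
        refine card_le_card fun A hA => ?_
        simp only [mem_insert, mem_singleton] at hA
        rcases hA with rfl | rfl <;> exact part_mem_parts _
      omega
    · intro A hA A' hA' h
      simp only [coe_erase, Set.mem_sdiff, mem_coe] at hA hA'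
      rw [← hz' A hA.1.1, ← hz' A' hA'.1.1, h]

/-- With the rest `R` fixed, linearity makes `a s t` a function of `s` plus a function of `t`, and
the minor cancels both. -/
theorem minor_eq_zero_of_linear {a : Fin n → Fin n → ℝ} (ha : ∀ i j, a i j = a j i)
    {u : Fin n → ℝ} {γ : ℝ} (h : ∀ B, IsTransversal 𝒜 B → pairSum a B = ∑ i ∈ B, u i + γ)
    {i k j l : Fin n} (hik : 𝒜.part i = 𝒜.part k) (hjl : 𝒜.part j = 𝒜.part l)
    (hij : 𝒜.part i ≠ 𝒜.part j) : minor a i k j l = 0 := by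
  obtain ⟨R, hR⟩ := exists_transversal_extension hij
  have key : ∀ s t, 𝒜.part s = 𝒜.part i → 𝒜.part t = 𝒜.part j →
      a s t = u s + u t - ∑ m ∈ R, a s m - ∑ m ∈ R, a t m + (∑ m ∈ R, u m + γ - pairSum a R) := by
    intro s t hs ht
    obtain ⟨h1, h2, h3⟩ := hR s t hs ht
    have := h _ h3
    rw [pairSum_insert ha h2, sum_insert h1, pairSum_insert ha h1, sum_insert h2,
      sum_insert h1] at this
    linarith
  rw [minor, key i j rfl rfl, key k l hik.symm hjl.symm, key i l rfl hjl.symm,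
    key k j hik.symm rfl]
  ring

/-- A symmetric matrix is finite on pairs from different parts and infinite on pairs of distinct
elements of the same part. -/
structure IsVCSPMatrix (𝒜 : Finpartition (univ : Finset (Fin n)))
    (a : Fin n → Fin n → WithTop ℝ) : Prop where
  symm : ∀ i j, a i j = a j i
  eq_top : ∀ i j, 𝒜.part i = 𝒜.part j → i ≠ j → a i j = ⊤
  lt_top : ∀ i j, 𝒜.part i ≠ 𝒜.part j → a i j < ⊤

theorem IsVCSPQuadratic.exists_matrix {f : Cube n → WithTop ℝ} (hf : IsVCSPQuadratic 𝒜 f) :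
    ∃ a b, IsVCSPMatrix 𝒜 a ∧ f = quadFun 𝒜.parts.card a b := by
  obtain ⟨a, b, h1, h2, h3, h4⟩ := hf
  exact ⟨a, b, ⟨h1, fun i j hij hne => h2 _ (part_mem_parts i) i (mem_own_part i) j
    (hij ▸ mem_own_part j) hne, fun i j hij => h3 _ (part_mem_parts i) _ (part_mem_parts j) hij i
    (mem_own_part i) j (mem_own_part j)⟩, h4⟩

theorem IsVCSPMatrix.quadFun_lt_top_iff {a : Fin n → Fin n → WithTop ℝ} (ha : IsVCSPMatrix 𝒜 a)
    {b : Fin n → ℝ} {x : Cube n} :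
    quadFun 𝒜.parts.card a b x < ⊤ ↔ IsTransversal 𝒜 (supp x) := by
  rw [quadFun_lt_top ha.symm]
  constructor
  · rintro ⟨h1, h2⟩
    refine ⟨fun i hi j hj hij => ?_, h1⟩
    by_contra hne
    exact (h2 i hi j hj hne).ne (ha.eq_top i j hij hne)
  · rintro ⟨h1, h2⟩
    exact ⟨h2, fun i hi j hj hij => ha.lt_top i j fun h => hij (h1 i hi j hj h)⟩

/-- The finite entries of a matrix. -/
noncomputable def realMat (a : Fin n → Fin n → WithTop ℝ) (i j : Fin n) : ℝ := (a i j).untopD 0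

theorem coe_realMat {a : Fin n → Fin n → WithTop ℝ} {i j : Fin n} (h : a i j < ⊤) :
    (realMat a i j : WithTop ℝ) = a i j := by
  unfold realMat
  lift a i j to ℝ using h.ne with t
  simp

theorem quadFun_eq_coe_of_isTransversal {a : Fin n → Fin n → WithTop ℝ}
    (ha : ∀ i j, 𝒜.part i ≠ 𝒜.part j → a i j < ⊤) (b : Fin n → ℝ) {x : Cube n}
    (hx : IsTransversal 𝒜 (supp x)) : quadFun 𝒜.parts.card a b x =
      ((pairSum (realMat a) (supp x) + ∑ i ∈ supp x, b i : ℝ) : WithTop ℝ) := by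
  rw [quadFun_eq, if_pos hx.2, WithTop.coe_add, ← pairSum_coe]
  congr 1
  refine pairSum_congr fun i hi j hj hij => ?_
  rw [coe_realMat (ha i j fun h => hij (hx.1 i hi j hj h))]

theorem IsVCSPMatrix.quadFun_eq_coe {a : Fin n → Fin n → WithTop ℝ} (ha : IsVCSPMatrix 𝒜 a)
    (b : Fin n → ℝ) {x : Cube n} (hx : IsTransversal 𝒜 (supp x)) :
    quadFun 𝒜.parts.card a b x =
      ((pairSum (realMat a) (supp x) + ∑ i ∈ supp x, b i : ℝ) : WithTop ℝ) :=
  quadFun_eq_coe_of_isTransversal ha.lt_top b hx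

theorem IsVCSPMatrix.aLinearEquiv_cutSum_iff {a : Fin n → Fin n → WithTop ℝ}
    (ha : IsVCSPMatrix 𝒜 a) (b : Fin n → ℝ) (F : Finset (Finset (Fin n)))
    (c : Finset (Fin n) → ℝ) :
    ALinearEquiv 𝒜 (quadFun 𝒜.parts.card a b) (cutSum F c) ↔
      CrossMinorsEq 𝒜 (realMat a) (cutMat F c) := by
  classical
  have hsymm : ∀ i j, realMat a i j - cutMat F c i j = realMat a j i - cutMat F c j i :=
    fun i j => by rw [cutMat_symm F c i j, realMat, realMat, ha.symm]
  have hminor : ∀ i k j l, minor (fun i j => realMat a i j - cutMat F c i j) i k j l =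
      minor (realMat a) i k j l - minor (cutMat F c) i k j l := fun i k j l => by
    simp only [minor]; ring
  constructor
  · rintro ⟨h, ⟨u, γ, hu⟩, hh⟩ i k j l hik hjl hij
    have := minor_eq_zero_of_linear (𝒜 := 𝒜) hsymm (u := fun i => u i - b i) (γ := γ)
      (fun B hB => ?_) hik hjl hij
    · rw [hminor] at this; linarith
    · have h1 := hh (ind B)
      rw [hu, delta_eq, supp_ind, if_pos hB, ha.quadFun_eq_coe b (by rwa [supp_ind]), cutSum_eq,
        supp_ind, add_zero, zero_add, sum_mul_coord, supp_ind] at h1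
      norm_cast at h1
      rw [pairSum_sub, sum_sub_distrib]
      linarith
  · intro h
    obtain ⟨u, γ, hu⟩ := exists_linear_of_minor_eq_zero (𝒜 := 𝒜) hsymm
      (fun i k j l h1 h2 h3 => by rw [hminor, h i k j l h1 h2 h3, sub_self])
    refine ⟨_, ⟨fun i => u i + b i, γ, fun x => rfl⟩, fun x => ?_⟩
    rw [delta_eq]
    split_ifs with hx
    · rw [ha.quadFun_eq_coe b hx, cutSum_eq, sum_mul_coord, add_zero, zero_add]
      have := hu _ hx
      rw [pairSum_sub] at this
      norm_cast
      rw [sum_add_distrib]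
      linarith
    · simp

theorem minor_cutMat (F : Finset (Finset (Fin n))) (c : Finset (Fin n) → ℝ) (i k j l : Fin n) :
    minor (cutMat F c) i k j l = ∑ X ∈ F, c X *
      (((if i ∈ X then 1 else 0) - (if k ∈ X then 1 else 0)) *
        ((if j ∈ X then 1 else 0) - (if l ∈ X then 1 else 0))) := by
  simp only [minor, cutMat]
  rw [← sum_add_distrib, ← sum_sub_distrib, ← sum_sub_distrib]
  exact sum_congr rfl fun X _ => by ring

end Basics

/-! ### M-convexity of laminar quadratic forms -/

section MConvexity

open Finset

variable {n : ℕ}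

theorem lt_apply_iff {x y : Cube n} {i : Fin n} : y i < x i ↔ i ∈ supp x ∧ i ∉ supp y := by
  simp only [mem_supp]
  generalize x i = s; generalize y i = t; revert s t; decide

theorem sub_add_unitVec_eq {x : Cube n} {i j : Fin n} (hi : i ∈ supp x) (hj : j ∉ supp x) :
    x - unitVec i + unitVec j = ind (insert j ((supp x).erase i)) := by
  have hne : i ≠ j := fun h => hj (h ▸ hi)
  funext k
  have hk := congrFun (ind_supp x) k
  simp only [Pi.add_apply, Pi.sub_apply, unitVec, ind, mem_insert, mem_erase, ← hk]
  by_cases h1 : k = i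
  · subst h1; simp [hi, hne]
  · by_cases h2 : k = j
    · subst h2; simp [hj, h1]
    · simp [h1, h2]

theorem mConvex_iff {f : Cube n → WithTop ℝ} :
    MConvex f ↔ ∀ B C : Finset (Fin n), f (ind B) < ⊤ → f (ind C) < ⊤ → ∀ i ∈ B, i ∉ C →
      ∃ j ∈ C, j ∉ B ∧ f (ind (insert j (B.erase i))) + f (ind (insert i (C.erase j))) ≤
        f (ind B) + f (ind C) := by
  constructor
  · intro h B C hB hC i hiB hiC
    obtain ⟨j, hj, hle⟩ := h _ _ hB hC i (lt_apply_iff.2 (by simpa using ⟨hiB, hiC⟩))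
    rw [gt_iff_lt, lt_apply_iff, supp_ind, supp_ind] at hj
    refine ⟨j, hj.1, hj.2, ?_⟩
    rw [ge_iff_le, add_sub_right_comm, sub_add_unitVec_eq (by simpa using hiB) (by simpa using hj.2),
      sub_add_unitVec_eq (by simpa using hj.1) (by simpa using hiC), supp_ind, supp_ind] at hle
    exact hle
  · intro h x y hx hy i hi
    rw [gt_iff_lt, lt_apply_iff] at hi
    obtain ⟨j, hj1, hj2, hle⟩ := h (supp x) (supp y) (by simpa using hx) (by simpa using hy) i
      hi.1 hi.2
    refine ⟨j, lt_apply_iff.2 ⟨hj1, hj2⟩, ?_⟩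
    rw [ge_iff_le, add_sub_right_comm, sub_add_unitVec_eq hi.1 hj2, sub_add_unitVec_eq hj1 hi.2]
    simpa using hle

/-- The inclusion-maximal members are pairwise disjoint and have the same union as the family. -/
theorem IsLaminar.sum_sup_nonneg {F : Finset (Finset (Fin n))} (hF : IsLaminar F) {w : Fin n → ℤ}
    (hw : ∀ Z ∈ F, 0 ≤ ∑ m ∈ Z, w m) : 0 ≤ ∑ m ∈ F.sup id, w m := by
  classical
  set M := F.filter fun Z => ∀ Z' ∈ F, Z ⊆ Z' → Z' = Z with hM
  have hsup : F.sup id = M.biUnion id := by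
    ext m
    simp only [mem_sup, id, mem_biUnion]
    constructor
    · rintro ⟨Z, hZ, hm⟩
      obtain ⟨Z', hZ', hmax⟩ := exists_max_image (F.filter fun Z' => Z ⊆ Z') card
        ⟨Z, mem_filter.2 ⟨hZ, Subset.rfl⟩⟩
      rw [mem_filter] at hZ'
      refine ⟨Z', mem_filter.2 ⟨hZ'.1, fun Z'' h1 h2 => ?_⟩, hZ'.2 hm⟩
      exact (eq_of_subset_of_card_le h2 (hmax Z'' (mem_filter.2 ⟨h1, hZ'.2.trans h2⟩))).symm
    · rintro ⟨Z, hZ, hm⟩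
      exact ⟨Z, (mem_filter.1 hZ).1, hm⟩
  rw [hsup, sum_biUnion]
  · exact sum_nonneg fun Z hZ => hw Z (mem_filter.1 hZ).1
  · intro Z hZ Z' hZ' hne
    rw [mem_coe, hM, mem_filter] at hZ hZ'
    rcases hF Z hZ.1 Z' hZ'.1 with h | h | h
    · exact absurd (hZ.2 Z' hZ'.1 h).symm hne
    · exact absurd (hZ'.2 Z hZ.1 h) hne
    · exact disjoint_iff_inter_eq_empty.2 h

theorem IsLaminar.insert_univ_singleton {F : Finset (Finset (Fin n))} (hF : IsLaminar F)
    (i : Fin n) : IsLaminar (insert {i} (insert univ F)) := by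
  have hs : ∀ Y : Finset (Fin n), {i} ⊆ Y ∨ {i} ∩ Y = ∅ := fun Y => by
    by_cases h : i ∈ Y
    · exact .inl (singleton_subset_iff.2 h)
    · exact .inr (singleton_inter_of_notMem h)
  intro X hX Y hY
  simp only [mem_insert] at hX hY
  rcases hX with rfl | rfl | hX
  · rcases hs Y with h | h
    · exact .inl h
    · exact .inr (.inr h)
  · exact .inr (.inl (subset_univ _))
  · rcases hY with rfl | rfl | hY
    · rcases hs X with h | h
      · exact .inr (.inl h)
      · exact .inr (.inr (by rwa [inter_comm]))
    · exact .inl (subset_univ _)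
    · exact hF X hX Y hY

/-- In a minimal member `X` containing `i` with `w(X) ≤ 0`, remove the proper submembers that a
partner must avoid. They cover a set of positive `w`-weight, so some `j` with `w j < 0` remains in
`X`. A member containing exactly one of `i, j` is nested in `X` by laminarity. -/
theorem IsLaminar.exists_exchange {F : Finset (Finset (Fin n))} (hF : IsLaminar F)
    {w : Fin n → ℤ} (hw : ∑ m, w m ≤ 0) {i : Fin n} (hi : 0 < w i) :
    ∃ j, w j < 0 ∧ ∀ X ∈ F, (i ∈ X → j ∉ X → 0 < ∑ m ∈ X, w m) ∧
      (j ∈ X → i ∉ X → ∑ m ∈ X, w m < 0) := by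
  classical
  have hF' := hF.insert_univ_singleton i
  set F' := insert {i} (insert univ F) with hF'def
  obtain ⟨X, hX, hmin⟩ := exists_min_image (F'.filter fun X => i ∈ X ∧ ∑ m ∈ X, w m ≤ 0) card
    ⟨univ, by simp [hF'def, hw]⟩
  simp only [mem_filter] at hX hmin
  obtain ⟨hXF, hiX, hXw⟩ := hX
  have hpos : ∀ Z ∈ F', i ∈ Z → Z ⊂ X → 0 < ∑ m ∈ Z, w m := by
    intro Z hZ hiZ hZX
    by_contra hcon
    exact (card_lt_card hZX).not_ge (hmin Z ⟨hZ, hiZ, not_lt.1 hcon⟩)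
  -- A partner outside these sets automatically meets both sign conditions.
  set Bad := F'.filter fun Z => Z ⊂ X ∧ (i ∈ Z ∨ 0 ≤ ∑ m ∈ Z, w m) with hBad
  have hlam : IsLaminar Bad := fun Y hY Z hZ =>
    hF' Y (mem_filter.1 hY).1 Z (mem_filter.1 hZ).1
  have hiBad : {i} ∈ Bad := by
    refine mem_filter.2 ⟨by simp [hF'def], ?_, .inl (mem_singleton_self i)⟩
    refine (singleton_subset_iff.2 hiX).ssubset_of_ne fun h => ?_
    rw [← h, sum_singleton] at hXw
    exact hi.not_ge hXw
  -- Lowering `w` by one at `i` uses integrality: positive sums stay nonnegative, and the union,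
  -- which contains `i`, gets weight at least one.
  have hsum := hlam.sum_sup_nonneg (w := fun m => w m - if m = i then 1 else 0) (by
    intro Z hZ
    obtain ⟨h1, h2, h3⟩ := mem_filter.1 hZ
    rw [sum_sub_distrib, sum_ite_eq' Z i]
    by_cases h : i ∈ Z
    · have := hpos Z h1 h h2
      simp only [h, if_true]; omega
    · have := h3.resolve_left h
      simp only [h, if_false]; omega)
  have hiW : i ∈ Bad.sup id := mem_sup.2 ⟨{i}, hiBad, mem_singleton_self i⟩
  rw [sum_sub_distrib, sum_ite_eq' _ i, if_pos hiW] at hsum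
  have hWX : Bad.sup id ⊆ X := Finset.sup_le fun Z hZ => (mem_filter.1 hZ).2.1.1
  have hsd := sum_sdiff (f := w) hWX
  obtain ⟨j, hj, hjw⟩ := exists_lt_of_sum_lt (s := X \ Bad.sup id) (f := w) (g := fun _ => 0)
    (by rw [sum_const_zero]; omega)
  obtain ⟨hjX, hjW⟩ := mem_sdiff.1 hj
  refine ⟨j, hjw, fun Y hY => ⟨fun hiY hjY => ?_, fun hjY hiY => ?_⟩⟩
  · have hYF : Y ∈ F' := by simp [hF'def, hY]
    refine hpos Y hYF hiY ?_
    rcases hF' Y hYF X hXF with h | h | h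
    · exact h.ssubset_of_ne fun e => hjY (e ▸ hjX)
    · exact absurd (h hjX) hjY
    · exact absurd (mem_inter.2 ⟨hiY, hiX⟩) (by simp [h])
  · have hYF : Y ∈ F' := by simp [hF'def, hY]
    by_contra hcon
    refine hjW (mem_sup.2 ⟨Y, mem_filter.2 ⟨hYF, ?_, .inr (not_lt.1 hcon)⟩, hjY⟩)
    rcases hF' Y hYF X hXF with h | h | h
    · exact h.ssubset_of_ne fun e => hiY (e ▸ hiX)
    · exact absurd (h hiX) hiY
    · exact absurd (mem_inter.2 ⟨hjY, hjX⟩) (by simp [h])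

theorem pairSum_indicator (X B : Finset (Fin n)) :
    pairSum (fun i j => (if i ∈ X then 1 else 0) * (if j ∈ X then 1 else 0) : _ → _ → ℝ) B =
      (∑ m ∈ B, if m ∈ X then 1 else 0) * ((∑ m ∈ B, if m ∈ X then 1 else 0) - 1) / 2 := by
  induction B using Finset.induction_on with
  | empty => simp [pairSum]
  | insert i B hi ih =>
    rw [pairSum_insert (fun _ _ => mul_comm _ _) hi, ih, sum_insert hi, ← mul_sum]
    split_ifs <;> ring

theorem pairSum_cutMat (F : Finset (Finset (Fin n))) (c : Finset (Fin n) → ℝ)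
    (B : Finset (Fin n)) : pairSum (cutMat F c) B = ∑ X ∈ F, c X *
      ((∑ m ∈ B, if m ∈ X then 1 else 0) * ((∑ m ∈ B, if m ∈ X then 1 else 0) - 1) / 2) := by
  simp only [← pairSum_indicator, pairSum, cutMat, mul_sum]
  rw [sum_comm]
  conv_rhs => rw [sum_comm]
  rw [sum_comm]
  exact sum_congr rfl fun i _ => sum_comm

theorem sum_insert_erase {B : Finset (Fin n)} {i j : Fin n} (hi : i ∈ B) (hj : j ∉ B)
    (g : Fin n → ℝ) : ∑ m ∈ insert j (B.erase i), g m = ∑ m ∈ B, g m - g i + g j := by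
  rw [sum_insert fun h => hj (mem_of_mem_erase h), ← add_sum_erase B g hi]
  ring

theorem quadFun_coe_ind {r : ℕ} (a : Fin n → Fin n → ℝ) (b : Fin n → ℝ) {B : Finset (Fin n)}
    (hB : B.card = r) : quadFun r (fun i j => (a i j : WithTop ℝ)) b (ind B) =
      ((pairSum a B + ∑ i ∈ B, b i : ℝ) : WithTop ℝ) := by
  rw [quadFun_eq, supp_ind, if_pos hB, pairSum_coe, WithTop.coe_add]

theorem card_insert_erase {B : Finset (Fin n)} {i j : Fin n} (hi : i ∈ B) (hj : j ∉ B) :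
    (insert j (B.erase i)).card = B.card := by
  rw [card_insert_of_notMem fun h => hj (mem_of_mem_erase h), card_erase_add_one hi]

/-- On a set `B`, `ℓ_X` is the convex function `s(s-1)/2` of `s = |B ∩ X|`. The exchange moves `|B ∩
X|` and `|C ∩ X|` only if `X` contains exactly one of `i, j`; by the choice of `j` the larger then
drops by one and the smaller rises by one, so the sum of values does not increase. -/
theorem IsLaminar.mConvex_quadFun {F : Finset (Finset (Fin n))} (hF : IsLaminar F)
    {c : Finset (Fin n) → ℝ} (hc : IsPosWeight F c) (r : ℕ) (b : Fin n → ℝ) :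
    MConvex (quadFun r (fun i j => (cutMat F c i j : WithTop ℝ)) b) := by
  rw [mConvex_iff]
  intro B C hB hC i hiB hiC
  replace hB := ((quadFun_lt_top fun i j => by rw [cutMat_symm]).1 hB).1
  replace hC := ((quadFun_lt_top fun i j => by rw [cutMat_symm]).1 hC).1
  rw [supp_ind] at hB hC
  set w : Fin n → ℤ := fun m => (if m ∈ B then 1 else 0) - (if m ∈ C then 1 else 0) with hw
  have hsum : ∀ X : Finset (Fin n), ((∑ m ∈ X, w m : ℤ) : ℝ) =
      (∑ m ∈ B, if m ∈ X then 1 else 0) - (∑ m ∈ C, if m ∈ X then 1 else 0) := by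
    intro X
    simp only [hw, sum_sub_distrib, sum_ite_mem, inter_comm X, sum_const]
    push_cast
    simp
  obtain ⟨j, hj, hjF⟩ := hF.exists_exchange (w := w) (i := i) (by
    simp [hw, sum_ite_mem, hB, hC]) (by simp [hw, hiB, hiC])
  have hjC : j ∈ C ∧ j ∉ B := by
    simp only [hw] at hj
    split_ifs at hj <;> simp_all
  refine ⟨j, hjC.1, hjC.2, ?_⟩
  rw [quadFun_coe_ind _ _ hB, quadFun_coe_ind _ _ hC,
    quadFun_coe_ind _ _ ((card_insert_erase hiB hjC.2).trans hB),
    quadFun_coe_ind _ _ ((card_insert_erase hjC.1 hiC).trans hC)]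
  norm_cast
  rw [sum_insert_erase hiB hjC.2, sum_insert_erase hjC.1 hiC]
  have key : pairSum (cutMat F c) (insert j (B.erase i)) +
      pairSum (cutMat F c) (insert i (C.erase j)) ≤
      pairSum (cutMat F c) B + pairSum (cutMat F c) C := by
    simp only [pairSum_cutMat, ← sum_add_distrib, ← mul_add]
    refine sum_le_sum fun X hX => mul_le_mul_of_nonneg_left ?_ (hc X hX).le
    rw [sum_insert_erase hiB hjC.2, sum_insert_erase hjC.1 hiC]
    obtain ⟨h1, h2⟩ := hjF X hX
    have h3 := hsum X
    set s : ℝ := ∑ m ∈ B, if m ∈ X then 1 else 0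
    set t : ℝ := ∑ m ∈ C, if m ∈ X then 1 else 0
    by_cases hiX : i ∈ X <;> by_cases hjX : j ∈ X
    · simp only [hiX, hjX, if_true]; nlinarith
    · have h4 : (1 : ℝ) ≤ ((∑ m ∈ X, w m : ℤ) : ℝ) := by exact_mod_cast h1 hiX hjX
      simp only [hiX, hjX, if_true, if_false]; nlinarith
    · have h4 : ((∑ m ∈ X, w m : ℤ) : ℝ) ≤ -1 := by
        exact_mod_cast Int.le_sub_one_of_lt (h2 hjX hiX)
      simp only [hiX, hjX, if_true, if_false]; nlinarith
    · simp only [hiX, hjX, if_false]; nlinarith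
  linarith

variable {𝒜 : Finpartition (univ : Finset (Fin n))}

open Classical in
/-- The matrix of the indicator function `δ_𝒜` as a quadratic function. -/
noncomputable def partMat (𝒜 : Finpartition (univ : Finset (Fin n))) (i j : Fin n) : WithTop ℝ :=
  if 𝒜.part i = 𝒜.part j ∧ i ≠ j then ⊤ else 0

theorem isVCSPMatrix_partMat : IsVCSPMatrix 𝒜 (partMat 𝒜) where
  symm i j := by
    unfold partMat
    exact if_congr ⟨fun h => ⟨h.1.symm, h.2.symm⟩, fun h => ⟨h.1.symm, h.2.symm⟩⟩ rfl rfl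
  eq_top i j h h' := by simp [partMat, h, h']
  lt_top i j h := by simp [partMat, h]

theorem quadFun_partMat : quadFun 𝒜.parts.card (partMat 𝒜) 0 = delta 𝒜 := by
  classical
  funext x
  rw [delta_eq]
  split_ifs with h
  · rw [isVCSPMatrix_partMat.quadFun_eq_coe 0 h]
    have : pairSum (realMat (partMat 𝒜)) (supp x) = 0 := by
      refine sum_eq_zero fun i hi => sum_eq_zero fun j hj => ?_
      rw [mem_filter] at hj
      have hij : 𝒜.part i ≠ 𝒜.part j := fun e => hj.2.ne (h.1 i hi j hj.1 e)
      simp [realMat, partMat, hij]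
    rw [this]; simp
  · exact not_lt_top_iff.1 fun h' => h (isVCSPMatrix_partMat.quadFun_lt_top_iff.1 h')

theorem IsTransversal.insert_erase {B : Finset (Fin n)} (hB : IsTransversal 𝒜 B) {i j : Fin n}
    (hi : i ∈ B) (hj : j ∉ B) (hij : 𝒜.part i = 𝒜.part j) :
    IsTransversal 𝒜 (insert j (B.erase i)) := by
  refine ⟨fun s hs t ht hst => ?_, (card_insert_erase hi hj).trans hB.2⟩
  simp only [mem_insert, mem_erase] at hs ht
  rcases hs with rfl | hs <;> rcases ht with rfl | ht
  · rfl
  · exact absurd (hB.1 i hi t ht.2 (hij.trans hst)).symm ht.1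
  · exact absurd (hB.1 i hi s hs.2 (hij.trans hst.symm)).symm hs.1
  · exact hB.1 s hs.2 t ht.2 hst

theorem delta_lt_top_iff {x : Cube n} : delta 𝒜 x < ⊤ ↔ IsTransversal 𝒜 (supp x) := by
  classical
  rw [delta_eq]; split_ifs with h <;> simp [h]

theorem mConvex_delta : MConvex (delta 𝒜) := by
  classical
  rw [mConvex_iff]
  intro B C hB hC i hiB hiC
  rw [delta_lt_top_iff, supp_ind] at hB hC
  -- The partner is the element of `C` in the part of `i`.
  obtain ⟨j, hj, hij⟩ := mem_image.1 (hC.image_part ▸ part_mem_parts (𝒜 := 𝒜) i)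
  have hjB : j ∉ B := fun h => hiC (hB.1 j h i hiB hij ▸ hj)
  refine ⟨j, hj, hjB, ?_⟩
  simp only [delta_eq, supp_ind, hB, hC, hB.insert_erase hiB hjB hij.symm,
    hC.insert_erase hj hiC hij, if_true, le_refl]

theorem IsVCSPMatrix.isQRM2Convex {a : Fin n → Fin n → WithTop ℝ} (ha : IsVCSPMatrix 𝒜 a)
    {b : Fin n → ℝ} {F : Finset (Finset (Fin n))} {c : Finset (Fin n) → ℝ}
    (hF : IsLaminar F) (hc : IsPosWeight F c)
    (h : CrossMinorsEq 𝒜 (realMat a) (cutMat F c)) :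
    IsQRM2Convex (quadFun 𝒜.parts.card a b) := by
  classical
  obtain ⟨u, γ, hu⟩ := exists_linear_of_minor_eq_zero (𝒜 := 𝒜)
    (a := fun i j => realMat a i j - cutMat F c i j)
    (fun i j => by rw [cutMat_symm F c i j, realMat, realMat, ha.symm])
    (fun i k j l h1 h2 h3 => by
      have := h i k j l h1 h2 h3
      simp only [minor] at this ⊢; linarith)
  -- Quadratic functions have no constant term, so `γ` is spread evenly over the elements of a
  -- transversal.
  refine ⟨quadFun 𝒜.parts.card (fun i j => (cutMat F c i j : WithTop ℝ))
    (fun i => u i + b i + γ / 𝒜.parts.card), delta 𝒜, ⟨_, _, _, fun i j => by rw [cutMat_symm], rfl⟩,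
    hF.mConvex_quadFun hc _ _, ⟨_, _, _, isVCSPMatrix_partMat.symm, quadFun_partMat.symm⟩,
    mConvex_delta, fun x => ?_⟩
  rw [delta_eq]
  split_ifs with hx
  · have h1 := hu _ hx
    have h2 := quadFun_coe_ind (cutMat F c) (fun i => u i + b i + γ / 𝒜.parts.card) hx.2
    rw [ind_supp] at h2
    rw [h2, ha.quadFun_eq_coe b hx, add_zero]
    norm_cast
    rw [pairSum_sub] at h1
    rw [sum_add_distrib, sum_add_distrib, sum_const, hx.2, nsmul_eq_mul]
    rcases Nat.eq_zero_or_pos 𝒜.parts.card with h0 | h0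
    · have he : supp x = ∅ := card_eq_zero.1 (hx.2.trans h0)
      rw [he] at h1 ⊢
      simp [pairSum, h0]
    · have : (𝒜.parts.card : ℝ) ≠ 0 := by positivity
      rw [mul_div_cancel₀ _ this]
      linarith
  · rw [add_top]
    exact not_lt_top_iff.1 fun h' => hx (ha.quadFun_lt_top_iff.1 h')

end MConvexity

/-! ### Equivalence of cuts and transfer of weights -/

section CutClasses

open Finset

variable {n : ℕ} {𝒜 : Finpartition (univ : Finset (Fin n))}

theorem cuts_part_iff {X : Finset (Fin n)} {i : Fin n} :
    Cuts X (𝒜.part i) ↔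
      (∃ k ∈ X, 𝒜.part k = 𝒜.part i) ∧ ∃ k ∉ X, 𝒜.part k = 𝒜.part i := by
  unfold Cuts
  refine and_congr ⟨fun ⟨k, hk⟩ => ?_, fun ⟨k, hk, hki⟩ => ?_⟩
    ⟨fun h => ?_, fun ⟨k, hk, hki⟩ h => ?_⟩
  · rw [mem_inter] at hk
    exact ⟨k, hk.1, (part_eq_iff (part_mem_parts i)).2 hk.2⟩
  · exact ⟨k, mem_inter.2 ⟨hk, (part_eq_iff (part_mem_parts i)).1 hki⟩⟩
  · by_contra! hcon
    refine h (inter_eq_right.2 fun k hk => ?_)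
    by_contra hkX
    exact hcon k hkX ((part_eq_iff (part_mem_parts i)).2 hk)
  · exact hk (inter_eq_right.1 h ((part_eq_iff (part_mem_parts i)).1 hki))

theorem mem_cutSupport {X : Finset (Fin n)} {i : Fin n} :
    i ∈ cutSupport 𝒜 X ↔ Cuts X (𝒜.part i) := by
  classical
  unfold cutSupport
  simp only [mem_sup, mem_filter, id]
  constructor
  · rintro ⟨A, ⟨hA, hc⟩, hi⟩
    rwa [(part_eq_iff hA).2 hi]
  · exact fun h => ⟨_, ⟨part_mem_parts i, h⟩, mem_own_part i⟩

theorem isCut_iff {X : Finset (Fin n)} :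
    IsCut 𝒜 X ↔ ∃ i ∈ cutSupport 𝒜 X, ∃ j ∈ cutSupport 𝒜 X, 𝒜.part i ≠ 𝒜.part j := by
  constructor
  · rintro ⟨A, hA, B, hB, hne, h1, h2⟩
    obtain ⟨i, hi⟩ := 𝒜.nonempty_of_mem_parts hA
    obtain ⟨j, hj⟩ := 𝒜.nonempty_of_mem_parts hB
    rw [← part_eq_iff hA] at hi
    rw [← part_eq_iff hB] at hj
    exact ⟨i, mem_cutSupport.2 (by rwa [hi]), j, mem_cutSupport.2 (by rwa [hj]), by rwa [hi, hj]⟩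
  · rintro ⟨i, hi, j, hj, hne⟩
    exact ⟨_, part_mem_parts i, _, part_mem_parts j, hne, mem_cutSupport.1 hi, mem_cutSupport.1 hj⟩

theorem mem_cutSupport_of_part_eq {X : Finset (Fin n)} {i k : Fin n}
    (h : 𝒜.part i = 𝒜.part k) (hi : i ∈ cutSupport 𝒜 X) : k ∈ cutSupport 𝒜 X := by
  rw [mem_cutSupport] at hi ⊢; rwa [← h]

/-- The bipartition of `⟨Z⟩` given by `Z` is also induced by `X`. -/
def Extends (𝒜 : Finpartition (univ : Finset (Fin n))) (X Z : Finset (Fin n)) : Prop :=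
  (∀ m ∈ cutSupport 𝒜 Z, m ∈ X ↔ m ∈ Z) ∨ (∀ m ∈ cutSupport 𝒜 Z, m ∈ X ↔ m ∉ Z)

theorem Extends.cutSupport_subset {X Z : Finset (Fin n)} (h : Extends 𝒜 X Z) :
    cutSupport 𝒜 Z ⊆ cutSupport 𝒜 X := by
  intro i hi
  obtain ⟨⟨k, hk, hki⟩, l, hl, hli⟩ := cuts_part_iff.1 (mem_cutSupport.1 hi)
  rw [mem_cutSupport, cuts_part_iff]
  have hk' := mem_cutSupport_of_part_eq hki.symm hi
  have hl' := mem_cutSupport_of_part_eq hli.symm hi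
  rcases h with h | h
  · exact ⟨⟨k, (h k hk').2 hk, hki⟩, l, fun hh => hl ((h l hl').1 hh), hli⟩
  · exact ⟨⟨l, (h l hl').2 hl, hli⟩, k, fun hh => (h k hk').1 hh hk, hki⟩

theorem Extends.trans {X Y Z : Finset (Fin n)} (h : Extends 𝒜 X Y) (h' : Extends 𝒜 Y Z) :
    Extends 𝒜 X Z := by
  have hs := h'.cutSupport_subset
  rcases h with h | h <;> rcases h' with h' | h'
  · exact .inl fun m hm => (h m (hs hm)).trans (h' m hm)
  · exact .inr fun m hm => (h m (hs hm)).trans (h' m hm)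
  · exact .inr fun m hm => (h m (hs hm)).trans (not_congr (h' m hm))
  · exact .inl fun m hm => (h m (hs hm)).trans (by rw [h' m hm, not_not])

theorem Extends.isCut {X Z : Finset (Fin n)} (h : Extends 𝒜 X Z) (hZ : IsCut 𝒜 Z) :
    IsCut 𝒜 X := by
  rw [isCut_iff] at hZ ⊢
  obtain ⟨i, hi, j, hj, hne⟩ := hZ
  exact ⟨i, h.cutSupport_subset hi, j, h.cutSupport_subset hj, hne⟩

theorem CutEquiv.cutSupport_eq {X Y : Finset (Fin n)} (h : CutEquiv 𝒜 X Y) :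
    cutSupport 𝒜 X = cutSupport 𝒜 Y := by
  have hX : cutSupport 𝒜 X = cutSupport 𝒜 X ∩ X ∪ cutSupport 𝒜 X \ X := by
    rw [union_comm, sdiff_union_inter]
  have hY : cutSupport 𝒜 Y = cutSupport 𝒜 Y ∩ Y ∪ cutSupport 𝒜 Y \ Y := by
    rw [union_comm, sdiff_union_inter]
  rcases Set.pair_eq_pair_iff.1 h with ⟨h1, h2⟩ | ⟨h1, h2⟩
  · rw [hX, h1, h2, ← hY]
  · rw [hX, h1, h2, union_comm, ← hY]

/-- This presents a class as the equal-support part of the preorder `Extends`, the form needed for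
the inversion in the uniqueness proof. -/
theorem cutEquiv_iff {X Y : Finset (Fin n)} :
    CutEquiv 𝒜 X Y ↔ cutSupport 𝒜 X = cutSupport 𝒜 Y ∧ Extends 𝒜 X Y := by
  constructor
  · intro h
    have hs := h.cutSupport_eq
    refine ⟨hs, ?_⟩
    rcases Set.pair_eq_pair_iff.1 h with ⟨h1, _⟩ | ⟨h1, _⟩
    · refine .inl fun m hm => ?_
      have := congrArg (m ∈ ·) h1
      simpa [hs, hm] using this
    · refine .inr fun m hm => ?_
      have := congrArg (m ∈ ·) h1
      simpa [hs, hm] using this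
  · rintro ⟨hs, h | h⟩
    · refine Set.pair_eq_pair_iff.2 (.inl ⟨?_, ?_⟩) <;> ext m <;> rw [hs] <;>
        by_cases hm : m ∈ cutSupport 𝒜 Y <;> simp [hm]
      · exact h m hm
      · exact not_congr (h m hm)
    · refine Set.pair_eq_pair_iff.2 (.inr ⟨?_, ?_⟩) <;> ext m <;> rw [hs] <;>
        by_cases hm : m ∈ cutSupport 𝒜 Y <;> simp [hm]
      · exact h m hm
      · rw [h m hm, not_not]

theorem CutEquiv.refl (X : Finset (Fin n)) : CutEquiv 𝒜 X X := rfl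

theorem CutEquiv.symm {X Y : Finset (Fin n)} (h : CutEquiv 𝒜 X Y) : CutEquiv 𝒜 Y X := Eq.symm h

theorem CutEquiv.trans {X Y Z : Finset (Fin n)} (h : CutEquiv 𝒜 X Y) (h' : CutEquiv 𝒜 Y Z) :
    CutEquiv 𝒜 X Z := Eq.trans h h'

theorem CutEquiv.isCut_iff {X Y : Finset (Fin n)} (h : CutEquiv 𝒜 X Y) :
    IsCut 𝒜 X ↔ IsCut 𝒜 Y :=
  ⟨(cutEquiv_iff.1 h.symm).2.isCut, (cutEquiv_iff.1 h).2.isCut⟩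

/-- The alternating sum of the matrix of `ℓ_X`. -/
def cutTerm (X : Finset (Fin n)) (i k j l : Fin n) : ℝ :=
  ((if i ∈ X then 1 else 0) - (if k ∈ X then 1 else 0)) *
    ((if j ∈ X then 1 else 0) - (if l ∈ X then 1 else 0))

theorem minor_cutMat_eq (F : Finset (Finset (Fin n))) (c : Finset (Fin n) → ℝ)
    (i k j l : Fin n) : minor (cutMat F c) i k j l = ∑ X ∈ F, c X * cutTerm X i k j l :=
  minor_cutMat F c i k j l

theorem mem_iff_of_notMem_cutSupport {X : Finset (Fin n)} {i k : Fin n}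
    (h : 𝒜.part i = 𝒜.part k) (hi : i ∉ cutSupport 𝒜 X) : i ∈ X ↔ k ∈ X := by
  rw [mem_cutSupport, cuts_part_iff] at hi
  constructor <;> intro h' <;> by_contra hcon
  · exact hi ⟨⟨i, h', rfl⟩, k, hcon, h.symm⟩
  · exact hi ⟨⟨k, h', h.symm⟩, i, hcon, rfl⟩

theorem cutTerm_eq_zero_left {X : Finset (Fin n)} {i k : Fin n} (j l : Fin n)
    (h : 𝒜.part i = 𝒜.part k) (hi : i ∉ cutSupport 𝒜 X) : cutTerm X i k j l = 0 := by
  simp [cutTerm, mem_iff_of_notMem_cutSupport h hi]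

theorem cutTerm_eq_zero_right {X : Finset (Fin n)} {j l : Fin n} (i k : Fin n)
    (h : 𝒜.part j = 𝒜.part l) (hj : j ∉ cutSupport 𝒜 X) : cutTerm X i k j l = 0 := by
  simp [cutTerm, mem_iff_of_notMem_cutSupport h hj]

theorem cutTerm_eq_zero_of_not_isCut {X : Finset (Fin n)} {i k j l : Fin n}
    (hX : ¬ IsCut 𝒜 X) (hik : 𝒜.part i = 𝒜.part k) (hjl : 𝒜.part j = 𝒜.part l)
    (hij : 𝒜.part i ≠ 𝒜.part j) : cutTerm X i k j l = 0 := by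
  by_cases hi : i ∈ cutSupport 𝒜 X
  · refine cutTerm_eq_zero_right i k hjl fun hj => hX (isCut_iff.2 ⟨i, hi, j, hj, hij⟩)
  · exact cutTerm_eq_zero_left j l hik hi

/-- Outside the common support both terms vanish; inside it, passing to the complementary side
changes the sign of both factors. -/
theorem CutEquiv.cutTerm_eq {X Y : Finset (Fin n)} (h : CutEquiv 𝒜 X Y) {i k j l : Fin n}
    (hik : 𝒜.part i = 𝒜.part k) (hjl : 𝒜.part j = 𝒜.part l) :
    cutTerm X i k j l = cutTerm Y i k j l := by
  obtain ⟨hs, he⟩ := cutEquiv_iff.1 h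
  by_cases hi : i ∈ cutSupport 𝒜 Y
  swap
  · rw [cutTerm_eq_zero_left j l hik hi, cutTerm_eq_zero_left j l hik (hs ▸ hi)]
  by_cases hj : j ∈ cutSupport 𝒜 Y
  swap
  · rw [cutTerm_eq_zero_right i k hjl hj, cutTerm_eq_zero_right i k hjl (hs ▸ hj)]
  have hk := mem_cutSupport_of_part_eq hik hi
  have hl := mem_cutSupport_of_part_eq hjl hj
  unfold cutTerm
  rcases he with he | he
  · simp only [he i hi, he k hk, he j hj, he l hl]
  · simp only [he i hi, he k hk, he j hj, he l hl, ite_not]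
    split_ifs <;> norm_num

/-- The `c`-weight of each class is shared equally among the members of `G` in it. The class
function `φ` is left free so as to cover both minors and class totals. -/
theorem FamilyEquiv.exists_weight {F G : Finset (Finset (Fin n))} (h : FamilyEquiv 𝒜 F G)
    {c : Finset (Fin n) → ℝ} (hc : IsPosWeight F c) :
    ∃ d : Finset (Fin n) → ℝ, IsPosWeight G d ∧ ∀ φ : Finset (Fin n) → ℝ,
      (∀ X Y, CutEquiv 𝒜 X Y → φ X = φ Y) → ∑ X ∈ F, c X * φ X = ∑ Y ∈ G, d Y * φ Y := by
  classical
  set N : Finset (Fin n) → ℝ := fun X => ((G.filter fun Y => CutEquiv 𝒜 X Y).card : ℝ)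
  have hN : ∀ X Y, CutEquiv 𝒜 X Y → N X = N Y := fun X Y hXY => by
    simp only [N]
    congr 2
    exact filter_congr fun W _ => ⟨fun hh => hXY.symm.trans hh, fun hh => hXY.trans hh⟩
  have hN0 : ∀ X ∈ F, N X ≠ 0 := fun X hX => by
    obtain ⟨Y, hY, hXY⟩ := h.1 X hX
    exact Nat.cast_ne_zero.2 (card_ne_zero_of_mem (mem_filter.2 ⟨hY, hXY⟩))
  refine ⟨fun Y => (∑ X ∈ F with CutEquiv 𝒜 X Y, c X) / N Y, fun Y hY => ?_, fun φ hφ => ?_⟩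
  · refine div_pos (sum_pos (fun X hX => hc X (mem_filter.1 hX).1) ?_) ?_
    · obtain ⟨X, hX, hYX⟩ := h.2 Y hY
      exact ⟨X, mem_filter.2 ⟨hX, hYX.symm⟩⟩
    · exact Nat.cast_pos.2 (card_pos.2 ⟨Y, mem_filter.2 ⟨hY, CutEquiv.refl Y⟩⟩)
  · have h1 : ∀ Y ∈ G, (∑ X ∈ F with CutEquiv 𝒜 X Y, c X) / N Y * φ Y =
        ∑ X ∈ F, if CutEquiv 𝒜 X Y then c X * φ X / N X else 0 := by
      intro Y _
      rw [sum_div, sum_mul, sum_filter]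
      refine sum_congr rfl fun X _ => ?_
      split_ifs with hXY
      · rw [hφ X Y hXY, hN X Y hXY]; ring
      · rfl
    rw [sum_congr rfl h1, sum_comm]
    refine sum_congr rfl fun X hX => ?_
    rw [← sum_filter, sum_const, nsmul_eq_mul]
    exact (mul_div_cancel₀ _ (hN0 X hX)).symm

theorem FamilyEquiv.exists_weight_minor {F G : Finset (Finset (Fin n))} (h : FamilyEquiv 𝒜 F G)
    {c : Finset (Fin n) → ℝ} (hc : IsPosWeight F c) [DecidableRel (CutEquiv 𝒜)] :
    ∃ d : Finset (Fin n) → ℝ, IsPosWeight G d ∧ CrossMinorsEq 𝒜 (cutMat F c) (cutMat G d) ∧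
      ∀ Z, ∑ X ∈ F with CutEquiv 𝒜 X Z, c X = ∑ Y ∈ G with CutEquiv 𝒜 Y Z, d Y := by
  obtain ⟨d, hd, hφ⟩ := h.exists_weight hc
  refine ⟨d, hd, fun i k j l hik hjl _ => ?_, fun Z => ?_⟩
  · rw [minor_cutMat_eq, minor_cutMat_eq]
    exact hφ _ fun X Y hXY => hXY.cutTerm_eq hik hjl
  · have := hφ (fun X => if CutEquiv 𝒜 X Z then 1 else 0) fun X Y hXY =>
      if_congr ⟨fun hh => hXY.symm.trans hh, fun hh => hXY.trans hh⟩ rfl rfl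
    simpa [mul_ite, sum_filter] using this

end CutClasses

/-! ### Quartets in laminar families and uniqueness -/

section Uniqueness

open Finset

variable {n : ℕ} {𝒜 : Finpartition (univ : Finset (Fin n))}

/-- If `R₁ p q` fails, then `p` is `R₂`-related to every other `m`: otherwise `R₁ p m`, and either
relation between `m` and `q` gives a contradiction by transitivity. All pairs are then `R₂`-related
through `p`. -/
theorem forall_or_forall_of_union_complete {ι : Type*} {P : ι → Prop} {R₁ R₂ : ι → ι → Prop}
    (s₂ : ∀ p q, R₂ p q → R₂ q p)
    (t₁ : ∀ p q s, P p → P q → P s → R₁ p q → R₁ q s → R₁ p s)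
    (t₂ : ∀ p q s, P p → P q → P s → R₂ p q → R₂ q s → R₂ p s)
    (h : ∀ p q, P p → P q → p ≠ q → R₁ p q ∨ R₂ p q) :
    (∀ p q, P p → P q → p ≠ q → R₁ p q) ∨ (∀ p q, P p → P q → p ≠ q → R₂ p q) := by
  by_contra! hcon
  obtain ⟨⟨p, q, hp, hq, hpq, h1⟩, ⟨s, t, hs, ht, hst, h2⟩⟩ := hcon
  have hall : ∀ m, P m → m ≠ p → R₂ p m := by
    intro m hm hmp
    have hpq2 := (h p q hp hq hpq).resolve_left h1
    by_contra hpm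
    have hpm1 := (h p m hp hm hmp.symm).resolve_right hpm
    have hmq : m ≠ q := fun e => hpm (e ▸ hpq2)
    rcases h m q hm hq hmq with h' | h'
    · exact h1 (t₁ p m q hp hm hq hpm1 h')
    · exact hpm (t₂ p q m hp hq hm hpq2 (s₂ _ _ h'))
  by_cases hsp : s = p
  · subst hsp; exact h2 (hall t ht hst.symm)
  · by_cases htp : t = p
    · subst htp; exact h2 (s₂ _ _ (hall s hs hsp))
    · exact h2 (t₂ s p t hs hp ht (s₂ _ _ (hall s hs hsp)) (hall t ht htp))

/-- Every element of `E` in the part `p` shares a member of `F` with every element of `E` in the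
part `q`. -/
def Linked (𝒜 : Finpartition (univ : Finset (Fin n))) (F : Finset (Finset (Fin n)))
    (E p q : Finset (Fin n)) : Prop :=
  ∀ i ∈ E, 𝒜.part i = p → ∀ j ∈ E, 𝒜.part j = q → ∃ S ∈ F, i ∈ S ∧ j ∈ S

theorem Linked.symm {F : Finset (Finset (Fin n))} {E p q : Finset (Fin n)}
    (h : Linked 𝒜 F E p q) : Linked 𝒜 F E q p := fun i hi hip j hj hjq => by
  obtain ⟨S, hS, h1, h2⟩ := h j hj hjq i hi hip
  exact ⟨S, hS, h2, h1⟩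

theorem IsLaminar.subset_or_subset {F : Finset (Finset (Fin n))} (hF : IsLaminar F)
    {X Y : Finset (Fin n)} (hX : X ∈ F) (hY : Y ∈ F) {m : Fin n} (hmX : m ∈ X) (hmY : m ∈ Y) :
    X ⊆ Y ∨ Y ⊆ X := by
  rcases hF X hX Y hY with h | h | h
  · exact .inl h
  · exact .inr h
  · exact absurd (mem_inter.2 ⟨hmX, hmY⟩) (by simp [h])

/-- The members through a fixed `i₀` form a chain; the largest one works. -/
theorem Linked.exists_common {F : Finset (Finset (Fin n))} (hF : IsLaminar F)
    {E p q : Finset (Fin n)} (hp : ∃ i ∈ E, 𝒜.part i = p) (hq : ∃ i ∈ E, 𝒜.part i = q)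
    (h : Linked 𝒜 F E p q) :
    ∃ S ∈ F, (∀ i ∈ E, 𝒜.part i = p → i ∈ S) ∧ (∀ i ∈ E, 𝒜.part i = q → i ∈ S) := by
  obtain ⟨i₀, hi₀, hi₀p⟩ := hp
  obtain ⟨j₀, hj₀, hj₀q⟩ := hq
  obtain ⟨S₀, hS₀, h1, -⟩ := h i₀ hi₀ hi₀p j₀ hj₀ hj₀q
  obtain ⟨S, hS, hmax⟩ := exists_max_image (F.filter fun S => i₀ ∈ S) card
    ⟨S₀, mem_filter.2 ⟨hS₀, h1⟩⟩
  obtain ⟨hSF, hiS⟩ := mem_filter.1 hS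
  have hsub : ∀ T ∈ F, i₀ ∈ T → T ⊆ S := fun T hT hiT => by
    rcases hF.subset_or_subset hT hSF hiT hiS with h' | h'
    · exact h'
    · exact (eq_of_subset_of_card_le h' (hmax T (mem_filter.2 ⟨hT, hiT⟩))).symm.subset
  have hq' : ∀ j ∈ E, 𝒜.part j = q → j ∈ S := fun j hj hjq => by
    obtain ⟨T, hT, h1, h2⟩ := h i₀ hi₀ hi₀p j hj hjq
    exact hsub T hT h1 h2
  refine ⟨S, hSF, fun i hi hip => ?_, hq'⟩
  obtain ⟨T, hT, h1, h2⟩ := h i hi hip j₀ hj₀ hj₀q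
  rcases hF.subset_or_subset hT hSF h2 (hq' j₀ hj₀ hj₀q) with h' | h'
  · exact h' h1
  · exact hsub T hT (h' hiS) h1

theorem Linked.trans {F : Finset (Finset (Fin n))} (hF : IsLaminar F)
    {E p q s : Finset (Fin n)} (hp : ∃ i ∈ E, 𝒜.part i = p) (hq : ∃ i ∈ E, 𝒜.part i = q)
    (hs : ∃ i ∈ E, 𝒜.part i = s) (h : Linked 𝒜 F E p q) (h' : Linked 𝒜 F E q s) :
    Linked 𝒜 F E p s := by
  obtain ⟨S, hS, h1, h2⟩ := h.exists_common hF hp hq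
  obtain ⟨T, hT, h3, h4⟩ := h'.exists_common hF hq hs
  obtain ⟨m, hm, hmq⟩ := hq
  intro i hi hip j hj hjs
  rcases hF.subset_or_subset hS hT (h2 m hm hmq) (h3 m hm hmq) with hh | hh
  · exact ⟨T, hT, hh (h1 i hi hip), h4 j hj hjs⟩
  · exact ⟨S, hS, h1 i hi hip, hh (h4 j hj hjs)⟩

/-- If all pairs of parts were linked, the largest member through `i₀` would contain all of `E`. -/
theorem not_forall_linked {F : Finset (Finset (Fin n))} (hF : IsLaminar F)
    {E : Finset (Fin n)} (hE : ∀ S ∈ F, ¬ E ⊆ S) {i₀ j₀ : Fin n} (hi₀ : i₀ ∈ E) (hj₀ : j₀ ∈ E)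
    (hij : 𝒜.part i₀ ≠ 𝒜.part j₀) :
    ¬ ∀ p q, (∃ i ∈ E, 𝒜.part i = p) → (∃ i ∈ E, 𝒜.part i = q) → p ≠ q →
      Linked 𝒜 F E p q := by
  classical
  intro h
  obtain ⟨S₀, hS₀, h1, -⟩ :=
    h _ _ ⟨i₀, hi₀, rfl⟩ ⟨j₀, hj₀, rfl⟩ hij i₀ hi₀ rfl j₀ hj₀ rfl
  obtain ⟨S, hS, hmax⟩ := exists_max_image (F.filter fun S => i₀ ∈ S) card
    ⟨S₀, mem_filter.2 ⟨hS₀, h1⟩⟩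
  obtain ⟨hSF, hiS⟩ := mem_filter.1 hS
  have hsub : ∀ T ∈ F, i₀ ∈ T → T ⊆ S := fun T hT hiT => by
    rcases hF.subset_or_subset hT hSF hiT hiS with h' | h'
    · exact h'
    · exact (eq_of_subset_of_card_le h' (hmax T (mem_filter.2 ⟨hT, hiT⟩))).symm.subset
  refine hE S hSF fun m hm => ?_
  -- Linking says nothing directly about two elements of one part; these are reached through the
  -- part of `j₀`.
  by_cases hmi : 𝒜.part m = 𝒜.part i₀
  · obtain ⟨T, hT, h3, h4⟩ := (h _ _ ⟨i₀, hi₀, rfl⟩ ⟨j₀, hj₀, rfl⟩ hij).exists_common hF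
      ⟨i₀, hi₀, rfl⟩ ⟨j₀, hj₀, rfl⟩
    exact hsub T hT (h3 i₀ hi₀ rfl) (h3 m hm hmi)
  · obtain ⟨T, hT, h3, h4⟩ := h _ _ ⟨i₀, hi₀, rfl⟩ ⟨m, hm, rfl⟩ (Ne.symm hmi) i₀ hi₀ rfl m hm rfl
    exact hsub T hT h3 h4

/-- `X` separates `{i, j}` from `{k, l}`. -/
def Separates (X : Finset (Fin n)) (i j k l : Fin n) : Prop :=
  (i ∈ X ∧ j ∈ X ∧ k ∉ X ∧ l ∉ X) ∨ (i ∉ X ∧ j ∉ X ∧ k ∈ X ∧ l ∈ X)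

theorem Separates.compl {X : Finset (Fin n)} {i j k l : Fin n} (h : Separates X i j k l) :
    Separates Xᶜ i j k l := by
  simp only [Separates, mem_compl, not_not] at h ⊢; tauto

theorem Extends.of_compl {X Z : Finset (Fin n)} (h : Extends 𝒜 Xᶜ Z) : Extends 𝒜 X Z := by
  simp only [Extends, mem_compl] at h ⊢
  rcases h with h | h
  · exact .inr fun m hm => by rw [← h m hm, not_not]
  · exact .inl fun m hm => not_iff_not.1 (h m hm)

/-- Re-rooting at `ρ`: complementing a member keeps its bipartition and lets all members avoid one
point. -/
theorem IsLaminar.image_avoiding {F : Finset (Finset (Fin n))} (hF : IsLaminar F) (ρ : Fin n) :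
    IsLaminar (F.image fun X => if ρ ∈ X then Xᶜ else X) := by
  intro X' hX' Y' hY'
  obtain ⟨X, hX, rfl⟩ := mem_image.1 hX'
  obtain ⟨Y, hY, rfl⟩ := mem_image.1 hY'
  split_ifs with h1 h2 h2
  · rcases hF.subset_or_subset hX hY h1 h2 with h | h
    · exact .inr (.inl (compl_subset_compl.2 h))
    · exact .inl (compl_subset_compl.2 h)
  · rcases hF X hX Y hY with h | h | h
    · exact absurd (h h1) h2
    · refine .inr (.inr ?_)
      rw [inter_comm, ← sdiff_eq_inter_compl]
      exact sdiff_eq_empty_iff_subset.2 h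
    · refine .inr (.inl fun m hm => mem_compl.2 fun hm' => ?_)
      exact absurd (mem_inter.2 ⟨hm', hm⟩) (by simp [h])
  · rcases hF X hX Y hY with h | h | h
    · refine .inr (.inr ?_)
      rw [← sdiff_eq_inter_compl]
      exact sdiff_eq_empty_iff_subset.2 h
    · exact absurd (h h2) h1
    · refine .inl fun m hm => mem_compl.2 fun hm' => ?_
      exact absurd (mem_inter.2 ⟨hm, hm'⟩) (by simp [h])
  · exact hF X hX Y hY

/-- Let `E₁`, `E₂` be the sides of `Z` in its support. A member that separates the quartet without
extending `Z` must be caught in one of two laminar families: `F₁`, none of whose members contains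
`E₁`, and `F₂`, none of whose members contains `E₂`. Neither links all pairs of parts, so some pair
of parts is linked by neither. Take `i, j` in `E₁` sharing no member of `F₁`, and `k, l` in `E₂`
sharing no member of `F₂`. -/
theorem exists_quartet_of_avoiding {F : Finset (Finset (Fin n))} (hF : IsLaminar F)
    {Z : Finset (Fin n)} (hZ : IsCut 𝒜 Z) {ρ : Fin n} (hρ : ρ ∈ cutSupport 𝒜 Z) (hρZ : ρ ∉ Z)
    (hFρ : ∀ X ∈ F, ρ ∉ X) :
    ∃ i j k l, 𝒜.part i = 𝒜.part k ∧ 𝒜.part j = 𝒜.part l ∧ 𝒜.part i ≠ 𝒜.part j ∧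
      i ∈ cutSupport 𝒜 Z ∧ j ∈ cutSupport 𝒜 Z ∧ i ∈ Z ∧ j ∈ Z ∧ k ∉ Z ∧ l ∉ Z ∧
      ∀ X ∈ F, Separates X i j k l → Extends 𝒜 X Z := by
  classical
  set E₁ := cutSupport 𝒜 Z ∩ Z with hE₁
  set E₂ := cutSupport 𝒜 Z \ Z with hE₂
  set F₁ := F.filter fun X => ¬ E₁ ⊆ X with hF₁
  -- Members containing `E₁` are complemented so that both kinds of failure show up as sets
  -- containing `k` and `l`.
  set F₂ := (F.filter fun X => E₁ ⊆ X ∧ (X ∩ E₂).Nonempty).image compl ∪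
    F.filter fun X => ¬ E₁ ⊆ X ∧ (X ∩ E₂).Nonempty with hF₂
  have lam₁ : IsLaminar F₁ := fun X hX Y hY => hF X (mem_filter.1 hX).1 Y (mem_filter.1 hY).1
  have part₁ : ∀ i ∈ cutSupport 𝒜 Z, ∃ k ∈ E₁, 𝒜.part k = 𝒜.part i := fun i hi => by
    obtain ⟨⟨k, hk, hki⟩, -⟩ := cuts_part_iff.1 (mem_cutSupport.1 hi)
    exact ⟨k, mem_inter.2 ⟨mem_cutSupport_of_part_eq hki.symm hi, hk⟩, hki⟩
  have part₂ : ∀ i ∈ cutSupport 𝒜 Z, ∃ k ∈ E₂, 𝒜.part k = 𝒜.part i := fun i hi => by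
    obtain ⟨-, ⟨k, hk, hki⟩⟩ := cuts_part_iff.1 (mem_cutSupport.1 hi)
    exact ⟨k, mem_sdiff.2 ⟨mem_cutSupport_of_part_eq hki.symm hi, hk⟩, hki⟩
  have sub₁ : E₁ ⊆ cutSupport 𝒜 Z := inter_subset_left
  have sub₂ : E₂ ⊆ cutSupport 𝒜 Z := sdiff_subset
  obtain ⟨e, he, -⟩ := part₁ ρ hρ
  have mix : ∀ X ∈ F, E₁ ⊆ X → ∀ Y ∈ F, ¬ E₁ ⊆ Y → Y ⊆ Xᶜ ∨ Xᶜ ∩ Y = ∅ := by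
    intro X hX hX' Y hY hY'
    rcases hF X hX Y hY with h | h | h
    · exact absurd (hX'.trans h) hY'
    · right
      rw [inter_comm, ← sdiff_eq_inter_compl]
      exact sdiff_eq_empty_iff_subset.2 h
    · left
      exact fun m hm => mem_compl.2 fun hm' => absurd (mem_inter.2 ⟨hm', hm⟩) (by simp [h])
  have lam₂ : IsLaminar F₂ := by
    intro X hX Y hY
    rw [hF₂, mem_union, mem_image, mem_filter] at hX hY
    rcases hX with ⟨X, hX, rfl⟩ | hX <;> rcases hY with ⟨Y, hY, rfl⟩ | hY
    · rw [mem_filter] at hX hY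
      rcases hF.subset_or_subset hX.1 hY.1 (hX.2.1 he) (hY.2.1 he) with h | h
      · exact .inr (.inl (compl_subset_compl.2 h))
      · exact .inl (compl_subset_compl.2 h)
    · rw [mem_filter] at hX
      exact .inr (mix X hX.1 hX.2.1 Y hY.1 hY.2.1)
    · rw [mem_filter] at hY
      rcases mix Y hY.1 hY.2.1 X hX.1 hX.2.1 with h | h
      · exact .inl h
      · exact .inr (.inr (by rwa [inter_comm]))
    · exact hF X hX.1 Y hY.1
  have hEF₁ : ∀ S ∈ F₁, ¬ E₁ ⊆ S := fun S hS => (mem_filter.1 hS).2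
  have hρE : ρ ∈ E₂ := mem_sdiff.2 ⟨hρ, hρZ⟩
  have hEF₂ : ∀ S ∈ F₂, ¬ E₂ ⊆ S := by
    intro S hS hES
    rw [hF₂, mem_union, mem_image, mem_filter] at hS
    rcases hS with ⟨X, hX, rfl⟩ | hS
    · obtain ⟨m, hm⟩ := (mem_filter.1 hX).2.2
      rw [mem_inter] at hm
      exact mem_compl.1 (hES hm.2) hm.1
    · exact hFρ S hS.1 (hES hρE)
  obtain ⟨i₀, hi₀, j₀, hj₀, hij₀⟩ := isCut_iff.1 hZ
  obtain ⟨i₁, hi₁, hi₁'⟩ := part₁ i₀ hi₀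
  obtain ⟨j₁, hj₁, hj₁'⟩ := part₁ j₀ hj₀
  obtain ⟨i₂, hi₂, hi₂'⟩ := part₂ i₀ hi₀
  obtain ⟨j₂, hj₂, hj₂'⟩ := part₂ j₀ hj₀
  have n₁ := not_forall_linked (𝒜 := 𝒜) lam₁ hEF₁ hi₁ hj₁ (by rwa [hi₁', hj₁'])
  have n₂ := not_forall_linked (𝒜 := 𝒜) lam₂ hEF₂ hi₂ hj₂ (by rwa [hi₂', hj₂'])
  have ex₁ : ∀ p, (∃ i ∈ cutSupport 𝒜 Z, 𝒜.part i = p) → ∃ i ∈ E₁, 𝒜.part i = p := by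
    rintro _ ⟨i, hi, rfl⟩; exact part₁ i hi
  have ex₂ : ∀ p, (∃ i ∈ cutSupport 𝒜 Z, 𝒜.part i = p) → ∃ i ∈ E₂, 𝒜.part i = p := by
    rintro _ ⟨i, hi, rfl⟩; exact part₂ i hi
  have hpq : ∃ p q, (∃ i ∈ cutSupport 𝒜 Z, 𝒜.part i = p) ∧
      (∃ i ∈ cutSupport 𝒜 Z, 𝒜.part i = q) ∧ p ≠ q ∧
      ¬ Linked 𝒜 F₁ E₁ p q ∧ ¬ Linked 𝒜 F₂ E₂ p q := by
    by_contra! hcon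
    rcases forall_or_forall_of_union_complete
      (P := fun p => ∃ i ∈ cutSupport 𝒜 Z, 𝒜.part i = p)
      (R₁ := Linked 𝒜 F₁ E₁) (R₂ := Linked 𝒜 F₂ E₂)
      (fun _ _ h => h.symm)
      (fun p q s hp hq hs => Linked.trans lam₁ (ex₁ p hp) (ex₁ q hq) (ex₁ s hs))
      (fun p q s hp hq hs => Linked.trans lam₂ (ex₂ p hp) (ex₂ q hq) (ex₂ s hs))
      (fun p q hp hq hpq => or_iff_not_imp_left.2 (hcon p q hp hq hpq)) with h | h
    · exact n₁ fun p q ⟨i, hi, hip⟩ ⟨j, hj, hjq⟩ => h p q ⟨i, sub₁ hi, hip⟩ ⟨j, sub₁ hj, hjq⟩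
    · exact n₂ fun p q ⟨i, hi, hip⟩ ⟨j, hj, hjq⟩ => h p q ⟨i, sub₂ hi, hip⟩ ⟨j, sub₂ hj, hjq⟩
  obtain ⟨p, q, -, -, hne, l₁, l₂⟩ := hpq
  unfold Linked at l₁ l₂
  push Not at l₁ l₂
  obtain ⟨i, hi, hip, j, hj, hjq, hij⟩ := l₁
  obtain ⟨k, hk, hkp, l, hl, hlq, hkl⟩ := l₂
  have hi' := mem_inter.1 hi
  have hj' := mem_inter.1 hj
  have hk' := mem_sdiff.1 hk
  have hl' := mem_sdiff.1 hl
  refine ⟨i, j, k, l, hip.trans hkp.symm, hjq.trans hlq.symm, by rwa [hip, hjq], hi'.1, hj'.1,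
    hi'.2, hj'.2, hk'.2, hl'.2, fun X hX hsep => ?_⟩
  -- If `i, j ∈ X`, then `X ∉ F₁` forces `E₁ ⊆ X`, and `Xᶜ ∉ F₂` forces `X` to miss `E₂`. If `k, l ∈
  -- X`, then `X` itself lies in `F₂`, a contradiction.
  rcases hsep with ⟨hiX, hjX, hkX, hlX⟩ | ⟨hiX, hjX, hkX, hlX⟩
  · have hsub : E₁ ⊆ X := by
      by_contra hcon
      exact hij X (mem_filter.2 ⟨hX, hcon⟩) hiX hjX
    have hdis : ¬ (X ∩ E₂).Nonempty := fun hcon =>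
      hkl Xᶜ (mem_union_left _ (mem_image.2 ⟨X, mem_filter.2 ⟨hX, hsub, hcon⟩, rfl⟩))
        (mem_compl.2 hkX) (mem_compl.2 hlX)
    refine .inl fun m hm => ⟨fun hmX => ?_, fun hmZ => hsub (mem_inter.2 ⟨hm, hmZ⟩)⟩
    by_contra hmZ
    exact hdis ⟨m, mem_inter.2 ⟨hmX, mem_sdiff.2 ⟨hm, hmZ⟩⟩⟩
  · exact absurd hlX (hkl X (mem_union_right _ (mem_filter.2 ⟨hX, fun h => hiX (h hi),
      ⟨k, mem_inter.2 ⟨hkX, hk⟩⟩⟩)) hkX)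

theorem IsLaminar.exists_quartet {F : Finset (Finset (Fin n))} (hF : IsLaminar F)
    {Z : Finset (Fin n)} (hZ : IsCut 𝒜 Z) :
    ∃ i j k l, 𝒜.part i = 𝒜.part k ∧ 𝒜.part j = 𝒜.part l ∧ 𝒜.part i ≠ 𝒜.part j ∧
      i ∈ cutSupport 𝒜 Z ∧ j ∈ cutSupport 𝒜 Z ∧ i ∈ Z ∧ j ∈ Z ∧ k ∉ Z ∧ l ∉ Z ∧
      ∀ X ∈ F, Separates X i j k l → Extends 𝒜 X Z := by
  obtain ⟨i₀, hi₀, -⟩ := isCut_iff.1 hZ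
  obtain ⟨-, ρ, hρ, hρi⟩ := cuts_part_iff.1 (mem_cutSupport.1 hi₀)
  obtain ⟨i, j, k, l, h1, h2, h3, h4, h5, h6, h7, h8, h9, h⟩ :=
    exists_quartet_of_avoiding (hF.image_avoiding ρ) hZ
      (mem_cutSupport_of_part_eq hρi.symm hi₀) hρ (by
        intro X hX
        obtain ⟨Y, -, rfl⟩ := mem_image.1 hX
        split_ifs with h
        · simpa using h
        · exact h)
  refine ⟨i, j, k, l, h1, h2, h3, h4, h5, h6, h7, h8, h9, fun X hX hs => ?_⟩
  have := h _ (mem_image_of_mem _ hX)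
  split_ifs at this
  · exact (this hs.compl).of_compl
  · exact this hs

theorem cutTerm_of_separates {X : Finset (Fin n)} {i k j l : Fin n} (h : Separates X i j k l) :
    cutTerm X i k j l = 1 := by
  rcases h with ⟨h1, h2, h3, h4⟩ | ⟨h1, h2, h3, h4⟩ <;> simp [cutTerm, h1, h2, h3, h4]

theorem cutTerm_nonpos {X : Finset (Fin n)} {i k j l : Fin n} (h : ¬ Separates X i j k l) :
    cutTerm X i k j l ≤ 0 := by
  unfold Separates at h
  unfold cutTerm
  split_ifs <;> first | (norm_num; done) | exact absurd (by tauto) h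

theorem separates_or_cutTerm_eq_zero {Y : Finset (Fin n)} {i k j l : Fin n}
    (h : ¬ Separates Y i j k l) : Separates Y i l k j ∨ cutTerm Y i k j l = 0 := by
  unfold Separates at h ⊢
  unfold cutTerm
  by_cases hi : i ∈ Y <;> by_cases hj : j ∈ Y <;> by_cases hk : k ∈ Y <;> by_cases hl : l ∈ Y <;>
    simp_all

theorem IsLaminar.not_cross {F : Finset (Finset (Fin n))} (hF : IsLaminar F)
    {X Y : Finset (Fin n)} (hX : X ∈ F) (hY : Y ∈ F) {a b c : Fin n} (ha : a ∈ X) (ha' : a ∈ Y)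
    (hb : b ∈ X) (hb' : b ∉ Y) (hc : c ∈ Y) (hc' : c ∉ X) : False := by
  rcases hF.subset_or_subset hX hY ha ha' with h | h
  · exact hb' (h hb)
  · exact hc' (h hc)

/-- A nonzero term would mean that `Y` separates `il|kj`; then each of `X ∩ Y`, `X \ Y`, `Y \ X`
contains a point of the quartet, against laminarity. -/
theorem IsLaminar.cutTerm_eq_zero {F : Finset (Finset (Fin n))} (hF : IsLaminar F)
    {X Y : Finset (Fin n)} (hX : X ∈ F) (hY : Y ∈ F) {i k j l : Fin n}
    (h : Separates X i j k l) (h' : ¬ Separates Y i j k l) : cutTerm Y i k j l = 0 := by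
  refine (separates_or_cutTerm_eq_zero h').resolve_left fun hs => ?_
  rcases h with ⟨h1, h2, h3, h4⟩ | ⟨h1, h2, h3, h4⟩ <;>
    rcases hs with ⟨h5, h6, h7, h8⟩ | ⟨h5, h6, h7, h8⟩
  · exact hF.not_cross hX hY h1 h5 h2 h8 h6 h4
  · exact hF.not_cross hX hY h2 h8 h1 h5 h7 h3
  · exact hF.not_cross hX hY h4 h6 h3 h7 h5 h1
  · exact hF.not_cross hX hY h3 h7 h4 h6 h8 h2

open Classical in
-- If some member separates `ij|kl`, no term of the minor is negative and the minor is the sum;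
-- otherwise all terms are nonpositive and the sum is empty.
theorem IsLaminar.sum_separates {F : Finset (Finset (Fin n))} (hF : IsLaminar F)
    {c : Finset (Fin n) → ℝ} (hc : IsPosWeight F c) (i k j l : Fin n) :
    ∑ X ∈ F with Separates X i j k l, c X = max (minor (cutMat F c) i k j l) 0 := by
  rw [minor_cutMat_eq]
  by_cases h : ∃ X ∈ F, Separates X i j k l
  · obtain ⟨X, hX, hs⟩ := h
    have : ∑ Y ∈ F, c Y * cutTerm Y i k j l = ∑ Y ∈ F with Separates Y i j k l, c Y := by
      rw [sum_filter]
      refine sum_congr rfl fun Y hY => ?_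
      split_ifs with h'
      · rw [cutTerm_of_separates h', mul_one]
      · rw [hF.cutTerm_eq_zero hX hY hs h', mul_zero]
    rw [this, max_eq_left]
    exact sum_nonneg fun Y hY => (hc Y (mem_filter.1 hY).1).le
  · push Not at h
    rw [filter_false_of_mem h, sum_empty, max_eq_right]
    exact sum_nonpos fun Y hY =>
      mul_nonpos_of_nonneg_of_nonpos (hc Y hY).le (cutTerm_nonpos (h Y hY))

open Classical in
-- The quartet is chosen for `G`. Members of `F` extending `Z` separate it, the separating weights
-- in `F` and `G` agree by the minors, and separating members of `G` extend `Z`.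
theorem IsLaminar.sum_extends_le {F G : Finset (Finset (Fin n))} (hF : IsLaminar F)
    (hG : IsLaminar G) {c d : Finset (Fin n) → ℝ} (hc : IsPosWeight F c) (hd : IsPosWeight G d)
    (h : CrossMinorsEq 𝒜 (cutMat F c) (cutMat G d)) {Z : Finset (Fin n)} (hZ : IsCut 𝒜 Z) :
    ∑ X ∈ F with Extends 𝒜 X Z, c X ≤ ∑ X ∈ G with Extends 𝒜 X Z, d X := by
  obtain ⟨i, j, k, l, hik, hjl, hij, hi, hj, hiZ, hjZ, hkZ, hlZ, hsep⟩ :=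
    hG.exists_quartet hZ
  have hk := mem_cutSupport_of_part_eq hik hi
  have hl := mem_cutSupport_of_part_eq hjl hj
  calc ∑ X ∈ F with Extends 𝒜 X Z, c X
      ≤ ∑ X ∈ F with Separates X i j k l, c X := by
        refine sum_le_sum_of_subset_of_nonneg (fun X hX => ?_)
          fun X hX _ => (hc X (mem_filter.1 hX).1).le
        rw [mem_filter] at hX ⊢
        refine ⟨hX.1, ?_⟩
        unfold Separates
        rcases hX.2 with he | he <;>
          simp [he i hi, he j hj, he k hk, he l hl, hiZ, hjZ, hkZ, hlZ]
    _ = ∑ X ∈ G with Separates X i j k l, d X := by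
        rw [hF.sum_separates hc, hG.sum_separates hd, h i k j l hik hjl hij]
    _ ≤ ∑ X ∈ G with Extends 𝒜 X Z, d X := by
        refine sum_le_sum_of_subset_of_nonneg (fun X hX => ?_)
          fun X hX _ => (hd X (mem_filter.1 hX).1).le
        rw [mem_filter] at hX ⊢
        exact ⟨hX.1, hsep X hX.1 hX.2⟩

open Classical in
-- Möbius-style inversion along `Extends`: the sets extending `Z` are the class of `Z` and whole
-- classes with strictly larger support, whose sums vanish by induction.
theorem sum_cutEquiv_eq_zero {w : Finset (Fin n) → ℝ}
    (hw : ∀ Z, IsCut 𝒜 Z → ∑ X with Extends 𝒜 X Z, w X = 0) (Z : Finset (Fin n))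
    (hZ : IsCut 𝒜 Z) : ∑ X with CutEquiv 𝒜 X Z, w X = 0 := by
  induction hm : (cutSupport 𝒜 Z)ᶜ.card using Nat.strong_induction_on generalizing Z with
  | _ m ih =>
  have hsplit := sum_filter_add_sum_filter_not (univ.filter fun X => Extends 𝒜 X Z)
    (fun X => cutSupport 𝒜 X = cutSupport 𝒜 Z) w
  rw [hw Z hZ, filter_filter, filter_filter] at hsplit
  have h1 : (univ.filter fun X => Extends 𝒜 X Z ∧ cutSupport 𝒜 X = cutSupport 𝒜 Z) =
      univ.filter fun X => CutEquiv 𝒜 X Z :=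
    filter_congr fun X _ => by rw [cutEquiv_iff, and_comm]
  have h2 : ∑ X with Extends 𝒜 X Z ∧ ¬ cutSupport 𝒜 X = cutSupport 𝒜 Z, w X = 0 := by
    refine sum_cancels_of_partition_cancels
      ⟨CutEquiv 𝒜, CutEquiv.refl, CutEquiv.symm, CutEquiv.trans⟩ fun X hX => ?_
    obtain ⟨-, hX, hne⟩ := mem_filter.1 hX
    have hlt : (cutSupport 𝒜 X)ᶜ.card < m := by
      rw [← hm]
      exact card_lt_card (compl_ssubset_compl.2 (hX.cutSupport_subset.ssubset_of_ne (Ne.symm hne)))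
    rw [← ih _ hlt X (hX.isCut hZ) rfl, filter_filter]
    refine sum_congr (filter_congr fun Y _ => ?_) fun _ _ => rfl
    refine ⟨fun hY => hY.2, fun hY => ⟨⟨?_, ?_⟩, hY⟩⟩
    · exact (cutEquiv_iff.1 hY).2.trans hX
    · rwa [CutEquiv.cutSupport_eq hY]
  rw [h1, h2, add_zero] at hsplit
  exact hsplit

open Classical in
theorem IsLaminar.sum_cutEquiv_eq {F G : Finset (Finset (Fin n))} (hF : IsLaminar F)
    (hG : IsLaminar G) {c d : Finset (Fin n) → ℝ} (hc : IsPosWeight F c) (hd : IsPosWeight G d)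
    (h : CrossMinorsEq 𝒜 (cutMat F c) (cutMat G d)) {Z : Finset (Fin n)} (hZ : IsCut 𝒜 Z) :
    ∑ X ∈ F with CutEquiv 𝒜 X Z, c X = ∑ X ∈ G with CutEquiv 𝒜 X Z, d X := by
  have hconv : ∀ p : Finset (Fin n) → Prop,
      ∑ X with p X, ((if X ∈ F then c X else 0) - (if X ∈ G then d X else 0)) =
        ∑ X ∈ F with p X, c X - ∑ X ∈ G with p X, d X := by
    intro p
    rw [sum_sub_distrib, sum_ite_mem, sum_ite_mem]
    congr 2 <;> ext X <;> simp [and_comm]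
  have := sum_cutEquiv_eq_zero (𝒜 := 𝒜)
    (w := fun X => (if X ∈ F then c X else 0) - (if X ∈ G then d X else 0)) (fun Z hZ => by
      rw [hconv, sub_eq_zero]
      exact le_antisymm (hF.sum_extends_le hG hc hd h hZ)
        (hG.sum_extends_le hF hd hc (fun i k j l h1 h2 h3 => (h i k j l h1 h2 h3).symm) hZ)) Z hZ
  rw [hconv, sub_eq_zero] at this
  exact this

theorem IsLaminarizable.weightEquiv {F G : Finset (Finset (Fin n))} (hF : IsLaminarizable 𝒜 F)
    (hG : IsLaminarizable 𝒜 G) {c d : Finset (Fin n) → ℝ} (hc : IsPosWeight F c)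
    (hd : IsPosWeight G d) (h : CrossMinorsEq 𝒜 (cutMat F c) (cutMat G d)) :
    WeightEquiv 𝒜 F c G d := by
  classical
  obtain ⟨hFc, F', hF'c, hF', hFF'⟩ := hF
  obtain ⟨hGc, G', hG'c, hG', hGG'⟩ := hG
  obtain ⟨c', hc', hcc', hsc⟩ := hFF'.exists_weight_minor hc
  obtain ⟨d', hd', hdd', hsd⟩ := hGG'.exists_weight_minor hd
  have hcut : ∀ Z, IsCut 𝒜 Z →
      ∑ Y ∈ F with CutEquiv 𝒜 Y Z, c Y = ∑ Y ∈ G with CutEquiv 𝒜 Y Z, d Y := by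
    intro Z hZ
    rw [hsc, hsd]
    exact hF'.sum_cutEquiv_eq hG' hc' hd' (fun i k j l h1 h2 h3 => by
      rw [← hcc' i k j l h1 h2 h3, h i k j l h1 h2 h3, hdd' i k j l h1 h2 h3]) hZ
  have hex : ∀ {F G : Finset (Finset (Fin n))} {c d : Finset (Fin n) → ℝ},
      IsPosWeight F c → IsCutFamily 𝒜 F → (∀ Z, IsCut 𝒜 Z →
        ∑ Y ∈ F with CutEquiv 𝒜 Y Z, c Y = ∑ Y ∈ G with CutEquiv 𝒜 Y Z, d Y) →
      ∀ X ∈ F, ∃ Y ∈ G, CutEquiv 𝒜 X Y := by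
    intro F G c d hc hFc hs X hX
    by_contra! hcon
    have h1 := hs X (hFc X hX)
    rw [filter_false_of_mem (s := G) fun Y hY hYX => hcon Y hY (CutEquiv.symm hYX),
      sum_empty] at h1
    refine (sum_pos (fun Y hY => hc Y (mem_filter.1 hY).1) ?_).ne' h1
    exact ⟨X, mem_filter.2 ⟨hX, CutEquiv.refl X⟩⟩
  refine ⟨⟨hex hc hFc hcut, hex hd hGc fun Z hZ => (hcut Z hZ).symm⟩, fun Z => ?_⟩
  by_cases hZ : IsCut 𝒜 Z
  · convert hcut Z hZ
  · rw [filter_false_of_mem (s := F) fun Y hY hYZ =>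
        hZ ((CutEquiv.isCut_iff hYZ).1 (hFc Y hY)),
      filter_false_of_mem (s := G) fun Y hY hYZ => hZ ((CutEquiv.isCut_iff hYZ).1 (hGc Y hY))]
    simp

end Uniqueness

/-! ### Laminar families from ultrametrics -/

section Ultrametric

open Finset

variable {n : ℕ}

/-- The weights are the gaps between consecutive elements of `V`; the least element gets weight one,
with `c₀` one below it. -/
theorem exists_telescoping_weight (V : Finset ℝ) :
    ∃ (ω : ℝ → ℝ) (c₀ : ℝ), (∀ v, 0 < ω v) ∧ ∀ w ∈ V, c₀ + ∑ v ∈ V with v ≤ w, ω v = w := by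
  induction V using Finset.induction_on_max with
  | empty => exact ⟨fun _ => 1, 0, fun _ => one_pos, by simp⟩
  | insert a s ha ih =>
    obtain ⟨ω, c₀, hω, hs⟩ := ih
    have has : a ∉ s := fun h => (ha a h).false
    obtain ⟨t, c₁, ht, hc, hc'⟩ : ∃ t c₁ : ℝ, 0 < t ∧ (c₁ + ∑ v ∈ s, ω v + t = a) ∧
        (s.Nonempty → c₁ = c₀) := by
      rcases s.eq_empty_or_nonempty with rfl | hne
      · exact ⟨1, a - 1, one_pos, by simp, by simp⟩
      · refine ⟨a - s.max' hne, c₀, sub_pos.2 (ha _ (s.max'_mem hne)), ?_, fun _ => rfl⟩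
        have := hs _ (s.max'_mem hne)
        rw [filter_true_of_mem fun v hv => s.le_max' v hv] at this
        linarith
    refine ⟨Function.update ω a t, c₁, fun v => ?_, fun w hw => ?_⟩
    · by_cases h : v = a
      · subst h; simpa using ht
      · simpa [Function.update_of_ne h] using hω v
    · have hupd : ∀ v ∈ s, Function.update ω a t v = ω v := fun v hv =>
        Function.update_of_ne (ha v hv).ne _ _
      rcases mem_insert.1 hw with rfl | hw
      · rw [filter_true_of_mem fun v hv => ?_, sum_insert has, sum_congr rfl hupd,
          Function.update_self]
        · linarith
        · rcases mem_insert.1 hv with rfl | hv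
          · exact le_rfl
          · exact (ha v hv).le
      · rw [filter_insert, if_neg (ha w hw).not_ge,
          sum_congr rfl fun v hv => hupd v (mem_filter.1 hv).1, hc' ⟨w, hw⟩]
        exact hs w hw

/-- Here a large `d` means closeness. By `hult` the relation `v ≤ d i j` is transitive, so each
level `v` partitions `D`, and raising `v` refines the partition. Each class gets the gap weight of
each of its levels, and the weights of the classes containing `i` and `j` telescope to `d i j - c₀`.
-/
theorem exists_laminar_of_ultrametric {D : Finset (Fin n)} {d : Fin n → Fin n → WithTop ℝ}
    (hd : ∀ i j, d i j = d j i)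
    (hult : ∀ i ∈ D, ∀ j ∈ D, ∀ k ∈ D, i ≠ j → i ≠ k → j ≠ k → d k j ≤ d i j ∨ d k i ≤ d i j) :
    ∃ (μ : Finset (Fin n) → ℝ) (c₀ : ℝ), (∀ X, 0 ≤ μ X) ∧
      IsLaminar (univ.filter fun X => 0 < μ X) ∧ (∀ X, 0 < μ X → X ⊆ D) ∧
      ∀ i ∈ D, ∀ j ∈ D, i ≠ j → d i j < ⊤ →
        d i j = ((c₀ + cutMat univ μ i j : ℝ) : WithTop ℝ) := by
  classical
  obtain ⟨ω, c₀, hω, hV⟩ :=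
    exists_telescoping_weight ((D ×ˢ D).image fun p => (d p.1 p.2).untopD 0)
  -- Infinite entries only add the level `0`; this is harmless, since telescoping works for any
  -- finite set containing the finite values.
  set V := (D ×ˢ D).image fun p => (d p.1 p.2).untopD 0
  let cls : ℝ → Fin n → Finset (Fin n) := fun v i => D.filter fun j => j = i ∨ (v : WithTop ℝ) ≤ d i j
  have hself : ∀ v, ∀ i ∈ D, i ∈ cls v i := fun v i hi => mem_filter.2 ⟨hi, .inl rfl⟩
  have hsymm : ∀ v, ∀ i ∈ D, ∀ j, j ∈ cls v i → i ∈ cls v j := by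
    intro v i hi j hj
    obtain ⟨-, rfl | h⟩ := mem_filter.1 hj
    · exact hj
    · exact mem_filter.2 ⟨hi, .inr (hd i j ▸ h)⟩
  have hsub : ∀ v, ∀ i ∈ D, ∀ j, j ∈ cls v i → cls v i ⊆ cls v j := by
    intro v i hi j hj k hk
    obtain ⟨hjD, hj'⟩ := mem_filter.1 hj
    obtain ⟨hkD, hk'⟩ := mem_filter.1 hk
    by_cases hij : j = i
    · rwa [hij]
    by_cases hki : k = i
    · rw [hki]; exact hsymm v i hi j hj
    by_cases hkj : k = j
    · rw [hkj]; exact hself v j hjD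
    have h1 := hj'.resolve_left hij
    have h2 := hk'.resolve_left hki
    refine mem_filter.2 ⟨hkD, .inr ?_⟩
    rcases hult j hjD k hkD i hi (Ne.symm hkj) hij hki with h | h
    · exact h2.trans h
    · exact h1.trans h
  have heq : ∀ v, ∀ X ∈ D.image (cls v), ∀ i ∈ X, X = cls v i ∧ i ∈ D := by
    intro v X hX i hi
    obtain ⟨j, hj, rfl⟩ := mem_image.1 hX
    have hiD := (mem_filter.1 hi).1
    exact ⟨(hsub v j hj i hi).antisymm (hsub v i hiD j (hsymm v j hj i hi)), hiD⟩
  set μ : Finset (Fin n) → ℝ := fun X => ∑ v ∈ V, if X ∈ D.image (cls v) then ω v else 0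
  have hμ : ∀ X, 0 < μ X → ∃ v, X ∈ D.image (cls v) := by
    intro X hX
    by_contra! hcon
    refine hX.ne' (sum_eq_zero fun v _ => if_neg (hcon v))
  refine ⟨μ, c₀, fun X => sum_nonneg fun v _ => ?_, fun X hX Y hY => ?_, fun X hX => ?_,
    fun i hi j hj hij hfin => ?_⟩
  · split_ifs
    exacts [(hω v).le, le_rfl]
  · obtain ⟨v, hv⟩ := hμ X (mem_filter.1 hX).2
    obtain ⟨w, hw⟩ := hμ Y (mem_filter.1 hY).2
    rcases (X ∩ Y).eq_empty_or_nonempty with h | ⟨m, hm⟩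
    · exact .inr (.inr h)
    rw [mem_inter] at hm
    have hmono : ∀ {v w : ℝ}, v ≤ w → cls w m ⊆ cls v m := fun {v w} hvw k hk => by
      obtain ⟨h1, h2⟩ := mem_filter.1 hk
      exact mem_filter.2 ⟨h1, h2.imp_right fun h => (WithTop.coe_le_coe.2 hvw).trans h⟩
    rw [(heq v X hv m hm.1).1, (heq w Y hw m hm.2).1]
    rcases le_total v w with h | h
    · exact .inr (.inl (hmono h))
    · exact .inl (hmono h)
  · obtain ⟨v, hv⟩ := hμ X hX
    exact fun m hm => (heq v X hv m hm).2
  · have hmat : cutMat univ μ i j = ∑ v ∈ V.filter fun v : ℝ => (v : WithTop ℝ) ≤ d i j, ω v := by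
      simp only [cutMat, μ, sum_mul]
      rw [sum_comm, sum_filter]
      refine sum_congr rfl fun v _ => ?_
      rw [sum_eq_single (cls v i)]
      · have : j ∈ cls v i ↔ (v : WithTop ℝ) ≤ d i j := by
          simp [cls, hj, hij.symm]
        simp only [if_pos (mem_image_of_mem (cls v) hi), if_pos (hself v i hi), this,
          mul_ite, mul_one, mul_zero]
      · intro X _ hX
        by_cases h1 : X ∈ D.image (cls v)
        · by_cases h2 : i ∈ X
          · exact absurd (heq v X h1 i h2).1 hX
          · simp [h2]
        · simp [h1]
      · simp
    rw [hmat]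
    have hmem : (d i j).untopD 0 ∈ V := mem_image.2 ⟨(i, j), mem_product.2 ⟨hi, hj⟩, rfl⟩
    have := hV _ hmem
    lift d i j to ℝ using hfin.ne with t
    simp only [WithTop.untopD_coe, WithTop.coe_le_coe] at this ⊢
    refine congrArg _ (this.symm.trans ?_)
    congr!

end Ultrametric

/-! ### Coefficients of quadratic M-convex functions and the decomposition -/

section Decomposition

open Finset

variable {n : ℕ} {𝒜 : Finpartition (univ : Finset (Fin n))}

/-- At most two parts contain several elements of `Q`, and `R` can leave these out. A part with just
one element `k` of `Q` offers the partner `k'`, and a part without any offers an arbitrary element.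
-/
theorem exists_partial_transversal (h2 : 2 ≤ 𝒜.parts.card) {Q : Finset (Fin n)}
    (hQ : Q.card ≤ 5) {rel : Fin n → Fin n → Prop}
    (h : ∀ k ∈ Q, (∃ k' ∈ Q, k' ≠ k ∧ 𝒜.part k' = 𝒜.part k) ∨
      ∃ k', k' ≠ k ∧ 𝒜.part k' = 𝒜.part k ∧ rel k k') :
    ∃ R : Finset (Fin n), R.card + 2 = 𝒜.parts.card ∧
      (∀ s ∈ R, ∀ t ∈ R, 𝒜.part s = 𝒜.part t → s = t) ∧
      ∀ s ∈ R, ∀ k ∈ Q, 𝒜.part s = 𝒜.part k → s ≠ k ∧ rel k s := by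
  classical
  set N : Finset (Fin n) → ℕ := fun A => (Q.filter fun k => 𝒜.part k = A).card with hN
  have hsum : ∑ A ∈ 𝒜.parts, N A = Q.card :=
    (card_eq_sum_card_fiberwise fun k _ => part_mem_parts k).symm
  -- Three such parts would need six elements of `Q`.
  have hbad : (𝒜.parts.filter fun A => ¬ N A ≤ 1).card ≤ 2 := by
    have h1 : (𝒜.parts.filter fun A => ¬ N A ≤ 1).card • 2 ≤
        ∑ A ∈ 𝒜.parts with ¬ N A ≤ 1, N A :=
      card_nsmul_le_sum _ _ _ fun A hA => by
        have := (mem_filter.1 hA).2; omega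
    have h2 : ∑ A ∈ 𝒜.parts with ¬ N A ≤ 1, N A ≤ ∑ A ∈ 𝒜.parts, N A :=
      sum_le_sum_of_subset (filter_subset _ _)
    rw [smul_eq_mul] at h1
    omega
  have hsplit := card_filter_add_card_filter_not (s := 𝒜.parts) (fun A => N A ≤ 1)
  have hex : ∀ A ∈ 𝒜.parts.filter fun A => N A ≤ 1, ∃ e, 𝒜.part e = A ∧
      ∀ k ∈ Q, 𝒜.part k = A → e ≠ k ∧ rel k e := by
    intro A hA
    obtain ⟨hA, hNA⟩ := mem_filter.1 hA
    by_cases hk : ∃ k ∈ Q, 𝒜.part k = A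
    · obtain ⟨k, hk, rfl⟩ := hk
      have huniq : ∀ m ∈ Q, 𝒜.part m = 𝒜.part k → m = k := fun m hm hmk =>
        card_le_one.1 hNA m (mem_filter.2 ⟨hm, hmk⟩) k (mem_filter.2 ⟨hk, rfl⟩)
      rcases h k hk with ⟨k', hk', hne, hp⟩ | ⟨k', hne, hp, hr⟩
      · exact absurd (huniq k' hk' hp) hne
      · refine ⟨k', hp, fun m hm hmk => ?_⟩
        rw [huniq m hm hmk]; exact ⟨hne, hr⟩
    · obtain ⟨e, he⟩ := 𝒜.nonempty_of_mem_parts hA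
      exact ⟨e, (part_eq_iff hA).2 he, fun k hk' hkA => absurd ⟨k, hk', hkA⟩ hk⟩
  have : Nonempty (Fin n) := by
    obtain ⟨A, hA⟩ := card_pos.1 (zero_lt_two.trans_le h2)
    exact (𝒜.nonempty_of_mem_parts hA).nonempty
  choose! e he1 he2 using hex
  have hcard : ((𝒜.parts.filter fun A => N A ≤ 1).image e).card =
      (𝒜.parts.filter fun A => N A ≤ 1).card :=
    card_image_of_injOn fun A hA B hB hAB => by rw [← he1 A hA, ← he1 B hB, hAB]
  obtain ⟨R, hR, hRc⟩ := exists_subset_card_eq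
    (s := (𝒜.parts.filter fun A => N A ≤ 1).image e) (n := 𝒜.parts.card - 2) (by omega)
  refine ⟨R, by omega, fun s hs t ht hst => ?_, fun s hs k hk hsk => ?_⟩
  · obtain ⟨A, hA, rfl⟩ := mem_image.1 (hR hs)
    obtain ⟨B, hB, rfl⟩ := mem_image.1 (hR ht)
    rw [he1 A hA, he1 B hB] at hst
    rw [hst]
  · obtain ⟨A, hA, rfl⟩ := mem_image.1 (hR hs)
    rw [he1 A hA] at hsk
    exact he2 A hA k hk hsk.symm

theorem pairSum_eq_coe {a : Fin n → Fin n → WithTop ℝ} {B : Finset (Fin n)}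
    (h : ∀ s ∈ B, ∀ t ∈ B, s ≠ t → a s t < ⊤) : pairSum a B = (pairSum (realMat a) B : ℝ) := by
  rw [← pairSum_coe]
  exact pairSum_congr fun i hi j hj hij => (coe_realMat (h i hi j hj hij)).symm

theorem quadFun_insert_insert {r : ℕ} {a : Fin n → Fin n → WithTop ℝ}
    (ha : ∀ i j, a i j = a j i) (b : Fin n → ℝ) {R : Finset (Fin n)} (hR : R.card + 2 = r)
    (hfin : ∀ s ∈ R, ∀ t ∈ R, s ≠ t → a s t < ⊤) {i j : Fin n} (hij : i ≠ j)
    (hi : i ∉ R) (hj : j ∉ R) (hiR : ∀ s ∈ R, a i s < ⊤) (hjR : ∀ s ∈ R, a j s < ⊤) :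
    quadFun r a b (ind (insert i (insert j R))) =
      a i j + (((∑ s ∈ R, realMat a i s + b i) + (∑ s ∈ R, realMat a j s + b j) +
        (pairSum (realMat a) R + ∑ s ∈ R, b s) : ℝ) : WithTop ℝ) := by
  have hij' : i ∉ insert j R := by simp [hij, hi]
  have hrow : ∀ m, (∀ s ∈ R, a m s < ⊤) →
      ∑ s ∈ R, a m s = ((∑ s ∈ R, realMat a m s : ℝ) : WithTop ℝ) := fun m hm => by
    rw [WithTop.coe_sum]
    exact sum_congr rfl fun s hs => (coe_realMat (hm s hs)).symm
  rw [quadFun_eq, supp_ind, if_pos (by rw [card_insert_of_notMem hij', card_insert_of_notMem hj]; exact hR),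
    pairSum_insert ha hij', pairSum_insert ha hj, sum_insert hj, sum_insert hij', sum_insert hj,
    pairSum_eq_coe hfin, hrow i hiR, hrow j hjR, add_assoc, add_assoc]
  congr 1
  norm_cast
  ring_nf

/-- Exchange `i` between `{i, j} ∪ R` and `{k, l} ∪ R`. All contributions involving `R` or `b` are
finite and occur equally on both sides. -/
theorem MConvex.exchange {r : ℕ} {a : Fin n → Fin n → WithTop ℝ} {b : Fin n → ℝ}
    (hm : MConvex (quadFun r a b)) (ha : ∀ i j, a i j = a j i) {R : Finset (Fin n)}
    (hR : R.card + 2 = r) (hfin : ∀ s ∈ R, ∀ t ∈ R, s ≠ t → a s t < ⊤) {i j k l : Fin n}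
    (hij : i ≠ j) (hik : i ≠ k) (hil : i ≠ l) (hjk : j ≠ k) (hjl : j ≠ l) (hkl : k ≠ l)
    (hi : i ∉ R) (hj : j ∉ R) (hk : k ∉ R) (hl : l ∉ R)
    (hiR : ∀ s ∈ R, a i s < ⊤) (hjR : ∀ s ∈ R, a j s < ⊤)
    (hkR : ∀ s ∈ R, a k s < ⊤) (hlR : ∀ s ∈ R, a l s < ⊤) :
    a k j + a i l ≤ a i j + a k l ∨ a l j + a k i ≤ a i j + a k l := by
  classical
  by_cases h1 : a i j < ⊤
  swap
  · left; rw [not_lt_top_iff.1 h1, top_add]; exact le_top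
  by_cases h2 : a k l < ⊤
  swap
  · left; rw [not_lt_top_iff.1 h2, add_top]; exact le_top
  have e := fun {s t : Fin n} => quadFun_insert_insert (i := s) (j := t) ha b hR hfin
  have cancel : ∀ {x y x' y' : WithTop ℝ} {p q p' q' : ℝ},
      (x + (p : WithTop ℝ)) + (y + (q : WithTop ℝ)) ≤
        (x' + (p' : WithTop ℝ)) + (y' + (q' : WithTop ℝ)) → p + q = p' + q' → x + y ≤ x' + y' := by
    intro x y x' y' p q p' q' h hpq
    rw [add_add_add_comm, add_add_add_comm x', ← WithTop.coe_add, ← WithTop.coe_add, hpq] at h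
    exact (WithTop.add_le_add_iff_right WithTop.coe_ne_top).1 h
  obtain ⟨m, hm1, hm2, hle⟩ := mConvex_iff.1 hm (insert i (insert j R)) (insert k (insert l R))
    (by rw [e hij hi hj hiR hjR]; exact WithTop.add_lt_top.2 ⟨h1, WithTop.coe_lt_top _⟩)
    (by rw [e hkl hk hl hkR hlR]; exact WithTop.add_lt_top.2 ⟨h2, WithTop.coe_lt_top _⟩)
    i (mem_insert_self _ _) (by simp [hik, hil, hi])
  rw [erase_insert (by simp [hij, hi]), e hij hi hj hiR hjR, e hkl hk hl hkR hlR] at hle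
  simp only [mem_insert, not_or] at hm1 hm2
  rcases hm1 with rfl | rfl | hm1
  · left
    rw [erase_insert (by simp [hkl, hk]), e (Ne.symm hjk) hk hj hkR hjR, e hil hi hl hiR hlR] at hle
    exact cancel hle (by ring)
  · right
    rw [insert_comm k m, erase_insert (by simp [hkl.symm, hl]), e (Ne.symm hjl) hl hj hlR hjR,
      e hik hi hk hiR hkR] at hle
    rw [ha k i]
    exact cancel hle (by ring)
  · exact absurd hm1 hm2.2.2

/-- A symmetric matrix, finite on pairs from different parts, of a quadratic M-convex function. -/
structure IsMConvexMatrix (𝒜 : Finpartition (univ : Finset (Fin n)))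
    (a : Fin n → Fin n → WithTop ℝ) : Prop where
  symm : ∀ i j, a i j = a j i
  lt_top : ∀ i j, 𝒜.part i ≠ 𝒜.part j → a i j < ⊤
  mConvex : ∃ b, MConvex (quadFun 𝒜.parts.card a b)

theorem IsMConvexMatrix.four_point {a : Fin n → Fin n → WithTop ℝ} (ha : IsMConvexMatrix 𝒜 a)
    (h2 : 2 ≤ 𝒜.parts.card) {Q : Finset (Fin n)} (hQ : Q.card ≤ 5)
    (h : ∀ k ∈ Q, (∃ k' ∈ Q, k' ≠ k ∧ 𝒜.part k' = 𝒜.part k) ∨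
      ∃ k', k' ≠ k ∧ 𝒜.part k' = 𝒜.part k ∧ a k k' < ⊤)
    {i j k l : Fin n} (hi : i ∈ Q) (hj : j ∈ Q) (hk : k ∈ Q) (hl : l ∈ Q)
    (hij : i ≠ j) (hik : i ≠ k) (hil : i ≠ l) (hjk : j ≠ k) (hjl : j ≠ l) (hkl : k ≠ l) :
    a k j + a i l ≤ a i j + a k l ∨ a l j + a k i ≤ a i j + a k l := by
  obtain ⟨b, hb⟩ := ha.mConvex
  obtain ⟨R, hR, hR1, hR2⟩ := exists_partial_transversal h2 hQ h
  have hQR : ∀ m ∈ Q, m ∉ R ∧ ∀ s ∈ R, a m s < ⊤ := by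
    refine fun m hm => ⟨fun hmR => (hR2 m hmR m hm rfl).1 rfl, fun s hs => ?_⟩
    by_cases hp : 𝒜.part s = 𝒜.part m
    · exact (hR2 s hs m hm hp).2
    · exact ha.lt_top _ _ (Ne.symm hp)
  exact hb.exchange ha.symm hR (fun s hs t ht hst => ha.lt_top s t fun h => hst (hR1 s hs t ht h))
    hij hik hil hjk hjl hkl (hQR i hi).1 (hQR j hj).1 (hQR k hk).1 (hQR l hl).1
    (hQR i hi).2 (hQR j hj).2 (hQR k hk).2 (hQR l hl).2

theorem exists_part_ne (h2 : 2 ≤ 𝒜.parts.card) (i : Fin n) : ∃ m, 𝒜.part m ≠ 𝒜.part i := by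
  obtain ⟨A, hA, hne⟩ := exists_mem_ne h2 (𝒜.part i)
  obtain ⟨m, hm⟩ := 𝒜.nonempty_of_mem_parts hA
  exact ⟨m, by rwa [(part_eq_iff hA).2 hm]⟩

theorem exists_ne_part_eq (h𝒜 : ∀ A ∈ 𝒜.parts, 2 ≤ A.card) (m : Fin n) :
    ∃ m', m' ≠ m ∧ 𝒜.part m' = 𝒜.part m := by
  obtain ⟨m', hm', hne⟩ := exists_mem_ne (h𝒜 _ (part_mem_parts m)) m
  exact ⟨m', hne, (part_eq_iff (part_mem_parts m)).2 hm'⟩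

/-- Were `a i k` finite, then for `m` in another part `a i k + a m j` would be finite, while the
other two pairings of `i, k, m, j` use `a i j` or `a j k` and are infinite. -/
theorem IsMConvexMatrix.eq_top_trans {a : Fin n → Fin n → WithTop ℝ} (ha : IsMConvexMatrix 𝒜 a)
    (h2 : 2 ≤ 𝒜.parts.card) (h𝒜 : ∀ A ∈ 𝒜.parts, 2 ≤ A.card) {i j k : Fin n}
    (hpij : 𝒜.part i = 𝒜.part j) (hpjk : 𝒜.part j = 𝒜.part k) (hij : i ≠ j) (hjk : j ≠ k)
    (hik : i ≠ k) (h1 : a i j = ⊤) (h3 : a j k = ⊤) : a i k = ⊤ := by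
  classical
  by_contra hcon
  obtain ⟨m, hm⟩ := exists_part_ne h2 i
  obtain ⟨m', hm', hpm'⟩ := exists_ne_part_eq h𝒜 m
  have hmi : m ≠ i := fun e => hm (e ▸ rfl)
  have hmj : m ≠ j := fun e => hm (e ▸ hpij.symm)
  have hmk : m ≠ k := fun e => hm (e ▸ (hpij.trans hpjk).symm)
  have hmj' : a m j ≠ ⊤ := (ha.lt_top m j fun h => hm (h.trans hpij.symm)).ne
  -- The fifth element `m'` only provides `m` with a companion in its part, so that the filler set
  -- can avoid that part.
  rcases ha.four_point h2 (Q := {i, j, k, m, m'}) card_le_five (by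
      intro q hq
      simp only [mem_insert, mem_singleton] at hq
      left
      rcases hq with rfl | rfl | rfl | rfl | rfl
      · exact ⟨j, by simp, hij.symm, hpij.symm⟩
      · exact ⟨i, by simp, hij, hpij⟩
      · exact ⟨j, by simp, hjk, hpjk⟩
      · exact ⟨m', by simp, hm', hpm'⟩
      · exact ⟨m, by simp, hm'.symm, hpm'.symm⟩)
    (i := i) (j := k) (k := m) (l := j) (by simp) (by simp) (by simp) (by simp) hik hmi.symm hij
    hmk.symm hjk.symm hmj with h | h
  · rw [h1, add_top, top_le_iff, WithTop.add_eq_top] at h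
    exact h.elim hcon hmj'
  · rw [h3, top_add, top_le_iff, WithTop.add_eq_top] at h
    exact h.elim hcon hmj'

/-- With `a i k = ⊤` only one alternative of the four-point inequality survives; used again with `j`
and `l` interchanged, it gives the reverse inequality. -/
theorem IsMConvexMatrix.minor_eq_zero {a : Fin n → Fin n → WithTop ℝ} (ha : IsMConvexMatrix 𝒜 a)
    (h2 : 2 ≤ 𝒜.parts.card) {i j k l : Fin n}
    (hik : 𝒜.part i = 𝒜.part k) (hjl : 𝒜.part j = 𝒜.part l) (hij : 𝒜.part i ≠ 𝒜.part j)
    (h : i = k ∨ a i k = ⊤) : minor (realMat a) i k j l = 0 := by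
  classical
  by_cases hik' : i = k
  · subst hik'; simp only [minor]; ring
  by_cases hjl' : j = l
  · subst hjl'; simp only [minor]; ring
  have htop : a k i = ⊤ := by rw [ha.symm]; exact h.resolve_left hik'
  have hpil : 𝒜.part i ≠ 𝒜.part l := fun e => hij (e.trans hjl.symm)
  have hpkj : 𝒜.part k ≠ 𝒜.part j := fun e => hij (hik.trans e)
  have hpkl : 𝒜.part k ≠ 𝒜.part l := fun e => hpkj (e.trans hjl.symm)
  have ne : ∀ {s t : Fin n}, 𝒜.part s ≠ 𝒜.part t → s ≠ t := fun h e => h (e ▸ rfl)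
  have hQ : ∀ q ∈ ({i, j, k, l} : Finset (Fin n)),
      (∃ k' ∈ ({i, j, k, l} : Finset (Fin n)), k' ≠ q ∧ 𝒜.part k' = 𝒜.part q) ∨
        ∃ k', k' ≠ q ∧ 𝒜.part k' = 𝒜.part q ∧ a q k' < ⊤ := by
    intro q hq
    simp only [mem_insert, mem_singleton] at hq
    left
    rcases hq with rfl | rfl | rfl | rfl
    · exact ⟨k, by simp, Ne.symm hik', hik.symm⟩
    · exact ⟨l, by simp, Ne.symm hjl', hjl.symm⟩
    · exact ⟨i, by simp, hik', hik⟩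
    · exact ⟨j, by simp, hjl', hjl⟩
  have f1 := ha.four_point h2 (card_le_four.trans (by norm_num)) hQ (i := i) (j := j) (k := k)
    (l := l) (by simp) (by simp) (by simp) (by simp) (ne hij) hik' (ne hpil) (ne hpkj).symm hjl'
    (ne hpkl)
  have f2 := ha.four_point h2 (card_le_four.trans (by norm_num)) hQ (i := i) (j := l) (k := k)
    (l := j) (by simp) (by simp) (by simp) (by simp) (ne hpil) hik' (ne hij) (ne hpkl).symm
    (Ne.symm hjl') (ne hpkj)
  rw [htop, add_top, top_le_iff, ← coe_realMat (ha.lt_top i j hij),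
    ← coe_realMat (ha.lt_top k l hpkl), ← coe_realMat (ha.lt_top i l hpil),
    ← coe_realMat (ha.lt_top k j hpkj), ← WithTop.coe_add, ← WithTop.coe_add] at f1 f2
  have g1 := WithTop.coe_le_coe.1 (f1.resolve_right WithTop.coe_ne_top)
  have g2 := WithTop.coe_le_coe.1 (f2.resolve_right WithTop.coe_ne_top)
  simp only [minor]
  linarith

/-- The part of `i` contains a pair of distinct elements at which the matrix `a` is finite. -/
def IsSplit (𝒜 : Finpartition (univ : Finset (Fin n))) (a : Fin n → Fin n → WithTop ℝ)
    (i : Fin n) : Prop :=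
  ∃ s t, 𝒜.part s = 𝒜.part i ∧ 𝒜.part t = 𝒜.part i ∧ s ≠ t ∧ a s t < ⊤

theorem IsSplit.of_part_eq {a : Fin n → Fin n → WithTop ℝ} {i k : Fin n} (h : IsSplit 𝒜 a i)
    (hik : 𝒜.part i = 𝒜.part k) : IsSplit 𝒜 a k := by
  obtain ⟨s, t, h1, h2, h3⟩ := h
  exact ⟨s, t, h1.trans hik, h2.trans hik, h3⟩

theorem IsMConvexMatrix.exists_lt_top_of_isSplit {a : Fin n → Fin n → WithTop ℝ}
    (ha : IsMConvexMatrix 𝒜 a) (h2 : 2 ≤ 𝒜.parts.card) (h𝒜 : ∀ A ∈ 𝒜.parts, 2 ≤ A.card)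
    {i : Fin n} (hi : IsSplit 𝒜 a i) : ∃ k, k ≠ i ∧ 𝒜.part k = 𝒜.part i ∧ a i k < ⊤ := by
  obtain ⟨s, t, hs, ht, hst, hlt⟩ := hi
  by_cases hsi : s = i
  · subst hsi; exact ⟨t, hst.symm, ht, hlt⟩
  by_cases hti : t = i
  · subst hti; exact ⟨s, hsi, hs, by rwa [ha.symm]⟩
  by_cases h1 : a i s < ⊤
  · exact ⟨s, hsi, hs, h1⟩
  refine ⟨t, hti, ht, lt_top_iff_ne_top.2 fun h3 => hlt.ne ?_⟩
  refine ha.eq_top_trans h2 h𝒜 hs ht.symm hsi (Ne.symm hti) hst ?_ h3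
  rw [ha.symm]; exact not_lt_top_iff.1 h1

theorem IsMConvexMatrix.minor_eq_zero_of_not_isSplit {a : Fin n → Fin n → WithTop ℝ}
    (ha : IsMConvexMatrix 𝒜 a) (h2 : 2 ≤ 𝒜.parts.card) {i j k l : Fin n}
    (hik : 𝒜.part i = 𝒜.part k) (hjl : 𝒜.part j = 𝒜.part l) (hij : 𝒜.part i ≠ 𝒜.part j)
    (h : ¬ IsSplit 𝒜 a i) : minor (realMat a) i k j l = 0 := by
  refine ha.minor_eq_zero h2 hik hjl hij (or_iff_not_imp_left.2 fun hne => ?_)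
  by_contra hcon
  exact h ⟨i, k, rfl, hik.symm, hne, lt_top_iff_ne_top.2 hcon⟩

theorem minor_swap {M : Fin n → Fin n → ℝ} (hM : ∀ i j, M i j = M j i) (i k j l : Fin n) :
    minor M i k j l = minor M j l i k := by
  simp only [minor, hM i j, hM k l, hM i l, hM k j]; ring

theorem realMat_symm {a : Fin n → Fin n → WithTop ℝ} (ha : ∀ i j, a i j = a j i) (i j : Fin n) :
    realMat a i j = realMat a j i := by rw [realMat, realMat, ha]

theorem cutMat_eq_zero_of_notMem {F : Finset (Finset (Fin n))} {c : Finset (Fin n) → ℝ}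
    {i : Fin n} (h : ∀ X ∈ F, i ∈ X → c X = 0) (j : Fin n) : cutMat F c i j = 0 := by
  refine sum_eq_zero fun X hX => ?_
  by_cases hi : i ∈ X
  · simp [h X hX hi]
  · simp [hi]

/-- The four-point inequality with base point `z` says that `a i j - a i z - a j z` satisfies the
ultrametric condition. The subtracted terms depend on one index each and do not affect minors. -/
theorem IsMConvexMatrix.exists_laminar_form {a : Fin n → Fin n → WithTop ℝ}
    (ha : IsMConvexMatrix 𝒜 a) (h2 : 2 ≤ 𝒜.parts.card) (h𝒜 : ∀ A ∈ 𝒜.parts, 2 ≤ A.card)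
    {z : Fin n} (hz : IsSplit 𝒜 a z) :
    ∃ μ : Finset (Fin n) → ℝ, (∀ X, 0 ≤ μ X) ∧ IsLaminar (univ.filter fun X => 0 < μ X) ∧
      (∀ X, 0 < μ X → ∀ i ∈ X, IsSplit 𝒜 a i) ∧
      ∀ i k j l, 𝒜.part i = 𝒜.part k → 𝒜.part j = 𝒜.part l → 𝒜.part i ≠ 𝒜.part j →
        IsSplit 𝒜 a i → IsSplit 𝒜 a j →
          minor (realMat a) i k j l = minor (cutMat univ μ) i k j l := by
  classical
  -- The other split elements are `z` and the elements at infinite coefficient from it. Their rows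
  -- have the same cross differences as that of `z`, and they lie in no set of positive weight.
  set D : Finset (Fin n) := univ.filter fun i => IsSplit 𝒜 a i ∧ i ≠ z ∧ a i z < ⊤ with hD
  have memD : ∀ i, i ∈ D ↔ IsSplit 𝒜 a i ∧ i ≠ z ∧ a i z < ⊤ := fun i => by simp [hD]
  have hex := fun {i : Fin n} => ha.exists_lt_top_of_isSplit h2 h𝒜 (i := i)
  obtain ⟨μ, c₀, hμ0, hlam, hμD, hform⟩ := exists_laminar_of_ultrametric (D := D)
    (d := fun i j => a i j + ((-realMat a i z - realMat a j z : ℝ) : WithTop ℝ))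
    (fun i j => by
      rw [ha.symm i j]
      congr 2
      ring)
    (by
      intro i hi j hj k hk hij hik hjk
      obtain ⟨si, iz, hi⟩ := (memD i).1 hi
      obtain ⟨sj, jz, hj⟩ := (memD j).1 hj
      obtain ⟨sk, kz, hk⟩ := (memD k).1 hk
      have cancel : ∀ {x y : WithTop ℝ} {p q p' q' : ℝ},
          x + (p : WithTop ℝ) ≤ y + (q : WithTop ℝ) → p - q = p' - q' →
            x + (p' : WithTop ℝ) ≤ y + (q' : WithTop ℝ) := by
        intro x y p q p' q' h hpq
        have h' := add_le_add_left h ((q' - q : ℝ) : WithTop ℝ)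
        rw [add_assoc, add_assoc, ← WithTop.coe_add, ← WithTop.coe_add] at h'
        convert h' using 3 <;> linarith
      have h4 := ha.four_point h2 (Q := {i, j, k, z}) (card_le_four.trans (by norm_num)) (by
          intro q hq
          right
          simp only [mem_insert, mem_singleton] at hq
          rcases hq with rfl | rfl | rfl | rfl
          exacts [hex si, hex sj, hex sk, hex hz])
        (i := i) (j := j) (k := k) (l := z) (by simp) (by simp) (by simp) (by simp)
        hij hik iz hjk jz kz
      rw [ha.symm z j, ← coe_realMat hi, ← coe_realMat hj, ← coe_realMat hk] at h4
      refine h4.imp (fun h => cancel h (by ring)) fun h => ?_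
      rw [add_comm] at h
      exact cancel h (by ring))
  have hreal : ∀ i ∈ D, ∀ j ∈ D, 𝒜.part i ≠ 𝒜.part j →
      realMat a i j = c₀ + cutMat univ μ i j + realMat a i z + realMat a j z := by
    intro i hi j hj hij
    have hlt := ha.lt_top i j hij
    have := hform i hi j hj (fun e => hij (e ▸ rfl))
      (WithTop.add_lt_top.2 ⟨hlt, WithTop.coe_lt_top _⟩)
    rw [← coe_realMat hlt, ← WithTop.coe_add] at this
    have := WithTop.coe_injective this
    linarith
  have hzero : ∀ i, i ∉ D → ∀ j, cutMat univ μ i j = 0 := by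
    refine fun i hi j => cutMat_eq_zero_of_notMem (fun X _ hiX => ?_) j
    by_contra hne
    exact hi (hμD X (lt_of_le_of_ne (hμ0 X) (Ne.symm hne)) hiX)
  have hrow : ∀ i j l, IsSplit 𝒜 a i → j ∈ D → l ∈ D → 𝒜.part j = 𝒜.part l →
      𝒜.part i ≠ 𝒜.part j → realMat a i j - realMat a i l =
        cutMat univ μ i j - cutMat univ μ i l + realMat a j z - realMat a l z := by
    intro i j l hi hj hl hjl hij
    by_cases hiD : i ∈ D
    · rw [hreal i hiD j hj hij, hreal i hiD l hl fun e => hij (e.trans hjl.symm)]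
      ring
    · have hiz : i = z ∨ a i z = ⊤ := by
        by_contra! hcon
        exact hiD ((memD i).2 ⟨hi, hcon.1, lt_top_iff_ne_top.2 hcon.2⟩)
      have hpiz : 𝒜.part i = 𝒜.part z := by
        by_contra hp
        rcases hiz with rfl | h
        · exact hp rfl
        · exact (ha.lt_top i z hp).ne h
      have := ha.minor_eq_zero h2 hpiz hjl hij hiz
      rw [hzero i hiD, hzero i hiD, realMat_symm ha.symm j z, realMat_symm ha.symm l z]
      simp only [minor] at this
      linarith
  have memD' : ∀ i, IsSplit 𝒜 a i → 𝒜.part i ≠ 𝒜.part z → i ∈ D := fun i hi hiz =>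
    (memD i).2 ⟨hi, fun e => hiz (e ▸ rfl), ha.lt_top i z hiz⟩
  have hmain : ∀ i k j l, 𝒜.part i = 𝒜.part k → 𝒜.part j = 𝒜.part l → 𝒜.part i ≠ 𝒜.part j →
      IsSplit 𝒜 a i → IsSplit 𝒜 a j → 𝒜.part j ≠ 𝒜.part z →
        minor (realMat a) i k j l = minor (cutMat univ μ) i k j l := by
    intro i k j l hik hjl hij hi hj hjz
    have hjD := memD' j hj hjz
    have hlD := memD' l (hj.of_part_eq hjl) (hjl ▸ hjz)
    have e1 := hrow i j l hi hjD hlD hjl hij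
    have e2 := hrow k j l (hi.of_part_eq hik) hjD hlD hjl (hik ▸ hij)
    simp only [minor]
    linarith
  refine ⟨μ, hμ0, hlam, fun X hX i hi => ((memD i).1 (hμD X hX hi)).1,
    fun i k j l hik hjl hij hi hj => ?_⟩
  -- At most one of the two parts is that of `z`, so by symmetry the columns can be taken inside
  -- `D`.
  by_cases hjz : 𝒜.part j = 𝒜.part z
  · rw [minor_swap (realMat_symm ha.symm), minor_swap (cutMat_symm univ μ)]
    exact hmain j l i k hjl hik hij.symm hj hi (hjz ▸ hij)
  · exact hmain i k j l hik hjl hij hi hj hjz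

theorem IsMConvexMatrix.exists_laminar {a : Fin n → Fin n → WithTop ℝ}
    (ha : IsMConvexMatrix 𝒜 a) (h2 : 2 ≤ 𝒜.parts.card) (h𝒜 : ∀ A ∈ 𝒜.parts, 2 ≤ A.card) :
    ∃ (L : Finset (Finset (Fin n))) (c : Finset (Fin n) → ℝ), IsCutFamily 𝒜 L ∧ IsLaminar L ∧
      IsPosWeight L c ∧ (∀ X ∈ L, ∀ i ∈ X, IsSplit 𝒜 a i) ∧
      CrossMinorsEq 𝒜 (realMat a) (cutMat L c) := by
  classical
  by_cases hz : ∃ z, IsSplit 𝒜 a z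
  swap
  · push Not at hz
    refine ⟨∅, 0, by simp [IsCutFamily], by simp [IsLaminar], by simp [IsPosWeight], by simp,
      fun i k j l hik hjl hij => ?_⟩
    rw [ha.minor_eq_zero_of_not_isSplit h2 hik hjl hij (hz i)]
    simp [minor, cutMat]
  obtain ⟨z, hz⟩ := hz
  obtain ⟨μ, hμ0, hlam, hsplit, hminor⟩ := ha.exists_laminar_form h2 h𝒜 hz
  have hnot : ∀ X, 0 < μ X → ∀ i k, ¬ IsSplit 𝒜 a i → 𝒜.part i = 𝒜.part k → i ∉ X ∧ k ∉ X :=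
    fun X hX i k hi hik => ⟨fun h => hi (hsplit X hX i h),
      fun h => hi ((hsplit X hX k h).of_part_eq hik.symm)⟩
  -- Sets that are not cuts contribute nothing to cross minors and are dropped.
  refine ⟨univ.filter fun X => 0 < μ X ∧ IsCut 𝒜 X, μ, fun X hX => (mem_filter.1 hX).2.2,
    fun X hX Y hY => hlam X (mem_filter.2 ⟨mem_univ _, (mem_filter.1 hX).2.1⟩) Y
      (mem_filter.2 ⟨mem_univ _, (mem_filter.1 hY).2.1⟩), fun X hX => (mem_filter.1 hX).2.1,
    fun X hX => hsplit X (mem_filter.1 hX).2.1, fun i k j l hik hjl hij => ?_⟩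
  by_cases hi : IsSplit 𝒜 a i
  swap
  · rw [ha.minor_eq_zero_of_not_isSplit h2 hik hjl hij hi, minor_cutMat_eq]
    refine (sum_eq_zero fun X hX => ?_).symm
    have := hnot X (mem_filter.1 hX).2.1 i k hi hik
    simp [cutTerm, this.1, this.2]
  by_cases hj : IsSplit 𝒜 a j
  swap
  · rw [minor_swap (realMat_symm ha.symm),
      ha.minor_eq_zero_of_not_isSplit h2 hjl hik hij.symm hj, minor_cutMat_eq]
    refine (sum_eq_zero fun X hX => ?_).symm
    have := hnot X (mem_filter.1 hX).2.1 j l hj hjl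
    simp [cutTerm, this.1, this.2]
  rw [hminor i k j l hik hjl hij hi hj, minor_cutMat_eq, minor_cutMat_eq]
  refine (sum_subset (filter_subset _ _) fun X _ hX => ?_).symm
  simp only [mem_filter, mem_univ, true_and, not_and] at hX
  rcases (hμ0 X).eq_or_lt with h | h
  · rw [← h, zero_mul]
  · rw [cutTerm_eq_zero_of_not_isCut (hX h) hik hjl hij, mul_zero]

/-- Inside the part, "equal or infinite" is transitive for each matrix, and the two relations
together cover all pairs; so one matrix is infinite on all pairs of the part. -/
theorem IsMConvexMatrix.not_isSplit_of_isSplit {a₁ a₂ : Fin n → Fin n → WithTop ℝ}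
    (ha₁ : IsMConvexMatrix 𝒜 a₁) (ha₂ : IsMConvexMatrix 𝒜 a₂) (h2 : 2 ≤ 𝒜.parts.card)
    (h𝒜 : ∀ A ∈ 𝒜.parts, 2 ≤ A.card)
    (h : ∀ i j, i ≠ j → 𝒜.part i = 𝒜.part j → a₁ i j = ⊤ ∨ a₂ i j = ⊤) {i : Fin n}
    (h₁ : IsSplit 𝒜 a₁ i) : ¬ IsSplit 𝒜 a₂ i := by
  rintro ⟨s', t', hs', ht', hst', hlt'⟩
  obtain ⟨s, t, hs, ht, hst, hlt⟩ := h₁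
  have trans : ∀ {a : Fin n → Fin n → WithTop ℝ}, IsMConvexMatrix 𝒜 a → ∀ p q s,
      𝒜.part p = 𝒜.part i → 𝒜.part q = 𝒜.part i → 𝒜.part s = 𝒜.part i →
        (p = q ∨ a p q = ⊤) → (q = s ∨ a q s = ⊤) → (p = s ∨ a p s = ⊤) := by
    intro a ha p q s hp hq hs hpq hqs
    by_cases e1 : p = q
    · rwa [e1]
    by_cases e2 : q = s
    · rwa [← e2]
    by_cases e3 : p = s
    · exact .inl e3
    · exact .inr (ha.eq_top_trans h2 h𝒜 (hp.trans hq.symm) (hq.trans hs.symm) e1 e2 e3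
        (hpq.resolve_left e1) (hqs.resolve_left e2))
  rcases forall_or_forall_of_union_complete (P := fun p => 𝒜.part p = 𝒜.part i)
    (R₁ := fun p q => p = q ∨ a₁ p q = ⊤) (R₂ := fun p q => p = q ∨ a₂ p q = ⊤)
    (fun p q h => by rwa [eq_comm, ha₂.symm]) (trans ha₁) (trans ha₂)
    (fun p q hp hq hpq => (h p q hpq (hp.trans hq.symm)).imp .inr .inr) with hh | hh
  · exact hlt.ne ((hh s t hs ht hst).resolve_left hst)
  · exact hlt'.ne ((hh s' t' hs' ht' hst').resolve_left hst')

/-- If both were finite, the sum would be finite at a set containing two elements of one part. -/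
theorem eq_top_or_eq_top_of_add {a a₁ a₂ : Fin n → Fin n → WithTop ℝ} {b b₁ b₂ : Fin n → ℝ}
    (ha : IsVCSPMatrix 𝒜 a) (ha₁ : IsMConvexMatrix 𝒜 a₁) (ha₂ : IsMConvexMatrix 𝒜 a₂)
    (h2 : 2 ≤ 𝒜.parts.card)
    (h : ∀ x, quadFun 𝒜.parts.card a b x =
      quadFun 𝒜.parts.card a₁ b₁ x + quadFun 𝒜.parts.card a₂ b₂ x) {i j : Fin n}
    (hij : i ≠ j) (hp : 𝒜.part i = 𝒜.part j) : a₁ i j = ⊤ ∨ a₂ i j = ⊤ := by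
  classical
  by_contra! hcon
  obtain ⟨R, hR, hR1, hR2⟩ := exists_partial_transversal h2 (Q := {i, j})
    -- The empty relation forces `R` to avoid the part of `i` and `j` altogether.
    (card_le_two.trans (by norm_num)) (rel := fun _ _ => False) (by
      intro q hq
      simp only [mem_insert, mem_singleton] at hq
      left
      rcases hq with rfl | rfl
      · exact ⟨j, by simp, hij.symm, hp.symm⟩
      · exact ⟨i, by simp, hij, hp⟩)
  have hiR : ∀ s ∈ R, 𝒜.part s ≠ 𝒜.part i := fun s hs e => (hR2 s hs i (by simp) e).2
  have hjR : ∀ s ∈ R, 𝒜.part s ≠ 𝒜.part j := fun s hs e => (hR2 s hs j (by simp) e).2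
  have hi : i ∉ R := fun hh => hiR i hh rfl
  have hj : j ∉ R := fun hh => hjR j hh rfl
  have fin : ∀ {a' : Fin n → Fin n → WithTop ℝ} {b' : Fin n → ℝ}, IsMConvexMatrix 𝒜 a' →
      a' i j ≠ ⊤ → quadFun 𝒜.parts.card a' b' (ind (insert i (insert j R))) < ⊤ := by
    intro a' b' ha' hne
    rw [quadFun_insert_insert ha'.symm b' hR
      (fun s hs t ht hst => ha'.lt_top s t fun e => hst (hR1 s hs t ht e)) hij hi hj
      (fun s hs => ha'.lt_top i s (hiR s hs).symm) (fun s hs => ha'.lt_top j s (hjR s hs).symm)]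
    exact WithTop.add_lt_top.2 ⟨lt_top_iff_ne_top.2 hne, WithTop.coe_lt_top _⟩
  have htr : IsTransversal 𝒜 (supp (ind (insert i (insert j R)))) := by
    rw [← ha.quadFun_lt_top_iff (b := b), h]
    exact WithTop.add_lt_top.2 ⟨fin ha₁ hcon.1, fin ha₂ hcon.2⟩
  rw [supp_ind] at htr
  exact hij (htr.1 i (by simp) j (by simp) hp)

theorem IsVCSPMatrix.exists_laminar_of_isQRM2Convex {a : Fin n → Fin n → WithTop ℝ}
    {b : Fin n → ℝ} (ha : IsVCSPMatrix 𝒜 a) (h𝒜 : ∀ A ∈ 𝒜.parts, 2 ≤ A.card)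
    (h : IsQRM2Convex (quadFun 𝒜.parts.card a b)) :
    ∃ (L : Finset (Finset (Fin n))) (c : Finset (Fin n) → ℝ), IsCutFamily 𝒜 L ∧ IsLaminar L ∧
      IsPosWeight L c ∧ CrossMinorsEq 𝒜 (realMat a) (cutMat L c) := by
  classical
  by_cases hne : ∃ i₀ j₀, 𝒜.part i₀ ≠ 𝒜.part j₀
  swap
  · push Not at hne
    exact ⟨∅, 0, by simp [IsCutFamily], by simp [IsLaminar], by simp [IsPosWeight],
      fun i k j l _ _ hij => absurd (hne i j) hij⟩
  obtain ⟨i₀, j₀, hne⟩ := hne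
  have h2 : 2 ≤ 𝒜.parts.card := by
    rw [← card_pair hne]
    refine card_le_card fun A hA => ?_
    simp only [mem_insert, mem_singleton] at hA
    rcases hA with rfl | rfl <;> exact part_mem_parts _
  obtain ⟨f₁, f₂, ⟨r₁, a₁, b₁, hs₁, rfl⟩, hm₁, ⟨r₂, a₂, b₂, hs₂, rfl⟩, hm₂, hf⟩ := h
  have hfin : ∀ B, IsTransversal 𝒜 B →
      quadFun r₁ a₁ b₁ (ind B) < ⊤ ∧ quadFun r₂ a₂ b₂ (ind B) < ⊤ := fun B hB => by
    rw [← WithTop.add_lt_top, ← hf, ha.quadFun_lt_top_iff, supp_ind]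
    exact hB
  obtain ⟨R₀, hR₀⟩ := exists_transversal_extension hne
  have htr₀ := (hR₀ i₀ j₀ rfl rfl).2.2
  -- Both summands are finite on transversals, which fixes their layer.
  obtain rfl : r₁ = 𝒜.parts.card := by
    rw [← ((quadFun_lt_top hs₁).1 (hfin _ htr₀).1).1, supp_ind, htr₀.2]
  obtain rfl : r₂ = 𝒜.parts.card := by
    rw [← ((quadFun_lt_top hs₂).1 (hfin _ htr₀).2).1, supp_ind, htr₀.2]
  have cross : ∀ i j, 𝒜.part i ≠ 𝒜.part j → a₁ i j < ⊤ ∧ a₂ i j < ⊤ := by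
    intro i j hij
    obtain ⟨R, hR⟩ := exists_transversal_extension hij
    have hB := hfin _ (hR i j rfl rfl).2.2
    have hne' : i ≠ j := fun e => hij (e ▸ rfl)
    rw [quadFun_lt_top hs₁, quadFun_lt_top hs₂, supp_ind] at hB
    exact ⟨hB.1.2 i (by simp) j (by simp) hne', hB.2.2 i (by simp) j (by simp) hne'⟩
  have ha₁ : IsMConvexMatrix 𝒜 a₁ := ⟨hs₁, fun i j hij => (cross i j hij).1, b₁, hm₁⟩
  have ha₂ : IsMConvexMatrix 𝒜 a₂ := ⟨hs₂, fun i j hij => (cross i j hij).2, b₂, hm₂⟩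
  have hns := fun {i : Fin n} => ha₁.not_isSplit_of_isSplit ha₂ h2 h𝒜
    (fun i j hij hp => eq_top_or_eq_top_of_add ha ha₁ ha₂ h2 hf hij hp) (i := i)
  obtain ⟨L₁, c₁, hcut₁, hlam₁, hpos₁, hsp₁, hmin₁⟩ := ha₁.exists_laminar h2 h𝒜
  obtain ⟨L₂, c₂, hcut₂, hlam₂, hpos₂, hsp₂, hmin₂⟩ := ha₂.exists_laminar h2 h𝒜
  -- Members of `L₁` and `L₂` live on parts split for different summands, so uniting the families
  -- keeps laminarity.
  have hinter : ∀ X ∈ L₁, ∀ Y ∈ L₂, X ∩ Y = ∅ := fun X hX Y hY =>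
    eq_empty_of_forall_notMem fun m hm => by
      rw [mem_inter] at hm
      exact hns (hsp₁ X hX m hm.1) (hsp₂ Y hY m hm.2)
  have hdisj : ∀ X ∈ L₂, X ∉ L₁ := by
    intro X hX hX'
    obtain ⟨A, _, _, _, _, ⟨⟨m, hm⟩, _⟩, _⟩ := hcut₁ X hX'
    have hmX := (mem_inter.1 hm).1
    exact absurd (mem_inter.2 ⟨hmX, hmX⟩) (by simp [hinter X hX' X hX])
  refine ⟨L₁ ∪ L₂, fun X => if X ∈ L₁ then c₁ X else c₂ X, fun X hX => ?_, fun X hX Y hY => ?_,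
    fun X hX => ?_, fun i k j l hik hjl hij => ?_⟩
  · rcases mem_union.1 hX with h | h
    exacts [hcut₁ X h, hcut₂ X h]
  · rcases mem_union.1 hX with hX | hX <;> rcases mem_union.1 hY with hY | hY
    · exact hlam₁ X hX Y hY
    · exact .inr (.inr (hinter X hX Y hY))
    · exact .inr (.inr (by rw [inter_comm]; exact hinter Y hY X hX))
    · exact hlam₂ X hX Y hY
  · rcases mem_union.1 hX with h | h
    · simpa [h] using hpos₁ X h
    · simpa [hdisj X h] using hpos₂ X h
  · have hzero := minor_eq_zero_of_linear (𝒜 := 𝒜)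
      (a := fun i j => realMat a i j - (realMat a₁ i j + realMat a₂ i j))
      (fun i j => by rw [realMat_symm ha.symm, realMat_symm hs₁, realMat_symm hs₂])
      (u := fun i => b₁ i + b₂ i - b i) (γ := 0) (fun B hB => by
        have := hf (ind B)
        rw [ha.quadFun_eq_coe b (by rwa [supp_ind]),
          quadFun_eq_coe_of_isTransversal ha₁.lt_top b₁ (by rwa [supp_ind]),
          quadFun_eq_coe_of_isTransversal ha₂.lt_top b₂ (by rwa [supp_ind]), supp_ind] at this
        norm_cast at this
        have hadd : pairSum (fun i j => realMat a₁ i j + realMat a₂ i j) B =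
            pairSum (realMat a₁) B + pairSum (realMat a₂) B := by
          simp [pairSum, sum_add_distrib]
        rw [pairSum_sub, hadd, sum_sub_distrib, sum_add_distrib]
        linarith) hik hjl hij
    have e1 := hmin₁ i k j l hik hjl hij
    have e2 := hmin₂ i k j l hik hjl hij
    have e3 : minor (cutMat (L₁ ∪ L₂) fun X => if X ∈ L₁ then c₁ X else c₂ X) i k j l =
        minor (cutMat L₁ c₁) i k j l + minor (cutMat L₂ c₂) i k j l := by
      simp only [minor_cutMat_eq]
      rw [sum_union (disjoint_right.2 hdisj)]
      congr 1
      · exact sum_congr rfl fun X hX => by rw [if_pos hX]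
      · exact sum_congr rfl fun X hX => by rw [if_neg (hdisj X hX)]
    rw [e3, ← e1, ← e2]
    simp only [minor] at hzero ⊢
    linarith

end Decomposition

end VCSPQuad

/-! ### The theorem -/

open VCSPQuad
theorem theorem2 {n : ℕ} (𝒜 : Finpartition (Finset.univ : Finset (Fin n)))
    (h𝒜 : ∀ A ∈ 𝒜.parts, 2 ≤ A.card)
    (f : Cube n → WithTop ℝ) (hf : IsVCSPQuadratic 𝒜 f) :
    (IsQRM2Convex f ↔
      ∃ (F : Finset (Finset (Fin n))) (c : Finset (Fin n) → ℝ),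
        IsLaminarizable 𝒜 F ∧ IsPosWeight F c ∧ ALinearEquiv 𝒜 f (cutSum F c)) ∧
    (IsQRM2Convex f ↔
      ∃ (L : Finset (Finset (Fin n))) (c : Finset (Fin n) → ℝ),
        IsCutFamily 𝒜 L ∧ IsLaminar L ∧ IsPosWeight L c ∧ ALinearEquiv 𝒜 f (cutSum L c)) ∧
    (∀ (F G : Finset (Finset (Fin n))) (c d : Finset (Fin n) → ℝ),
      IsLaminarizable 𝒜 F → IsPosWeight F c → ALinearEquiv 𝒜 f (cutSum F c) →
      IsLaminarizable 𝒜 G → IsPosWeight G d → ALinearEquiv 𝒜 f (cutSum G d) →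
      FamilyEquiv 𝒜 F G ∧ WeightEquiv 𝒜 F c G d) := by
  classical
  obtain ⟨a, b, ha, rfl⟩ := hf.exists_matrix
  simp only [ha.aLinearEquiv_cutSum_iff b]
  have laminar_of_convex := ha.exists_laminar_of_isQRM2Convex (b := b) h𝒜
  refine ⟨⟨fun h => ?_, ?_⟩, ⟨laminar_of_convex, ?_⟩, ?_⟩
  · obtain ⟨L, c, hL, hlam, hc, hm⟩ := laminar_of_convex h
    exact ⟨L, c, ⟨hL, L, hL, hlam, fun X hX => ⟨X, hX, CutEquiv.refl X⟩,
      fun X hX => ⟨X, hX, CutEquiv.refl X⟩⟩, hc, hm⟩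
  · rintro ⟨F, c, ⟨-, L, -, hlam, hFL⟩, hc, hm⟩
    obtain ⟨d, hd, hcd, -⟩ := hFL.exists_weight_minor hc
    exact ha.isQRM2Convex hlam hd fun i k j l h1 h2 h3 =>
      (hm i k j l h1 h2 h3).trans (hcd i k j l h1 h2 h3)
  · rintro ⟨L, c, -, hlam, hc, hm⟩
    exact ha.isQRM2Convex hlam hc hm
  · intro F G c d hF hc hfF hG hd hfG
    have := hF.weightEquiv hG hc hd fun i k j l h1 h2 h3 =>
      (hfF i k j l h1 h2 h3).symm.trans (hfG i k j l h1 h2 h3)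
    exact ⟨this.1, this⟩
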